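/- Let $q\ge p$ be nonnegative integers. Let $S$ be the group of complex lower triangular $p\times p$ matrices with real positive diagonal entries, and let $N$ be the Heisenberg group of pairs $(n,z)$, where $n$ is a skew-Hermitian $p\times p$ matrix and $z\in Z=\mathbb C^{p\times(q-p)}$, with the multiplication $(n_1,z_1)(n_2,z_2)=(n_1+n_2-\tfrac12(z_1z_2^*-z_2z_1^*),\,z_1+z_2)$. Let $P=S\ltimes N$ be the Iwasawa group of $U(p,q)$, where $s\in S$ acts on $N$ by $g=(n,z)\mapsto g^s=sgs^{-1}=(sns^*,sz)$. For $\epsilon=(\epsilon_1,\dots,\epsilon_p)$, $\epsilon_i=\pm1$, let the Bargmann space $K^\epsilon$ be the subspace of $L^2(Z,e^{-\operatorname{tr}ww^*}dw)$ of the functions that are holomorphic in the rows $w_i$ of $w$ with $\epsilon_i=1$ and antiholomorphic in the rows $w_i$ with $\epsilon_i=-1$, with the unitary representation $T^\epsilon$ of $N$, $$T^\epsilon(n,z)f(w)=\exp\Big(\sum_{i=1}^p\big(\epsilon_in_{ii}-\tfrac12z_iz_i^*\big)-\sum_{\epsilon_i=1}w_iz_i^*-\sum_{\epsilon_i=-1}z_iw_i^*\Big)f(w+z).$$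 For $s\in S$ let $K^\epsilon_s$ be the same space, regarded as a space of functions of $w=sz$, with the representation $T^\epsilon_s(g)=T^\epsilon(g^s)$ of $N$. A $\sigma$-finite Borel measure $\nu\neq0$ on $S$ is called almost invariant if it is quasi-invariant under the right translations $s\mapsto ss_0$ and the derivative $d\nu(ss_0)/d\nu(s)$ is bounded for every $s_0\in S$. For such a $\nu$ let $T_\epsilon=T_{\epsilon,\nu}$ be the (in general nonunitary) representation of $P$ by bounded operators in the direct integral $\int_S^{\oplus}K^\epsilon_s\,d\nu(s)$ given by $(T_\epsilon(g)f)(s)=T^\epsilon_s(g)f(s)$ for $g\in N$ and $(T_\epsilon(s_0)f)(s)=f(ss_0)$ for $s_0\in S$. Theorem. (i) For every $\epsilon$ and every almost invariant measure $\nu$ the representation $T_{\epsilon,\nu}$ is operator-irreducible: its space is nonzero, and every bounded operator commuting with all operators $T_{\epsilon,\nu}(g)$, $g\in P$, is a scalar multiple of the identity. (ii) The representations $T_\epsilon$ are pairwise nonequivalent: if $\epsilon\ne\epsilon'$, then for all almost invariant measures $\nu,\nu'$ (in particular, for $\nu=\nu'$) no bounded operator with bounded inverse intertwines $T_{\epsilon,\nu}$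 and $T_{\epsilon',\nu'}$. -/

import Mathlib

open MeasureTheory Matrix Topology
open scoped ENNReal NNReal ComplexConjugate

noncomputable section

namespace Iwasawa

/-! ### The groups `S`, `N` and `P = S ⋌ N` -/

/-- The group `S` of complex lower triangular matrices of order `p` whose diagonal entries are
real and positive. -/
def S (p : ℕ) : Subgroup (GL (Fin p) ℂ) where
  carrier := {s | (∀ i j, i < j → (s : Matrix (Fin p) (Fin p) ℂ) i j = 0) ∧
    ∀ i, ∃ r : ℝ, 0 < r ∧ (s : Matrix (Fin p) (Fin p) ℂ) i i = r}
  one_mem' := by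
    refine ⟨fun i j hij => ?_, fun i => ⟨1, one_pos, ?_⟩⟩
    · simp [hij.ne]
    · simp
  mul_mem' := by
    rintro a b ⟨ha, ha'⟩ ⟨hb, hb'⟩
    refine ⟨fun i j hij => ?_, fun i => ?_⟩
    · rw [Units.val_mul, Matrix.mul_apply]
      refine Finset.sum_eq_zero fun k _ => ?_
      rcases lt_or_ge i k with h | h
      · rw [ha i k h, zero_mul]
      · rw [hb k j (lt_of_le_of_lt h hij), mul_zero]
    · obtain ⟨r, hr, hr'⟩ := ha' i
      obtain ⟨t, ht, ht'⟩ := hb' i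
      refine ⟨r * t, mul_pos hr ht, ?_⟩
      rw [Units.val_mul, Matrix.mul_apply, Finset.sum_eq_single i]
      · rw [hr', ht', Complex.ofReal_mul]
      · intro k _ hk
        rcases lt_or_gt_of_ne hk with h | h
        · rw [hb k i h, mul_zero]
        · rw [ha i k h, zero_mul]
      · simp
  inv_mem' := by
    rintro a ⟨ha, ha'⟩
    have hinv : ∀ i j, i < j → ((a⁻¹ : GL (Fin p) ℂ) : Matrix (Fin p) (Fin p) ℂ) i j = 0 := by
      have h1 : (a : Matrix (Fin p) (Fin p) ℂ).BlockTriangular (OrderDual.toDual) := by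
        intro i j hij
        exact ha i j (OrderDual.toDual_lt_toDual.1 hij)
      have : Invertible (a : Matrix (Fin p) (Fin p) ℂ) := a.invertible
      have h2 := Matrix.blockTriangular_inv_of_blockTriangular h1
      intro i j hij
      rw [Matrix.coe_units_inv]
      exact h2 (OrderDual.toDual_lt_toDual.2 hij)
    refine ⟨hinv, fun i => ?_⟩
    obtain ⟨r, hr, hr'⟩ := ha' i
    refine ⟨r⁻¹, inv_pos.2 hr, ?_⟩
    have h : ((a * a⁻¹ : GL (Fin p) ℂ) : Matrix (Fin p) (Fin p) ℂ) i i = 1 := by simp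
    rw [Units.val_mul, Matrix.mul_apply, Finset.sum_eq_single i] at h
    · rw [hr'] at h
      rw [Complex.ofReal_inv]
      exact eq_inv_of_mul_eq_one_right h
    · intro k _ hk
      rcases lt_or_gt_of_ne hk with h | h
      · rw [hinv k i h, mul_zero]
      · rw [ha i k h, zero_mul]
    · simp

/-- `S` carries the Borel σ-algebra of its usual topology. -/
instance (p : ℕ) : MeasurableSpace (S p) := borel (S p)

instance (p : ℕ) : BorelSpace (S p) := ⟨rfl⟩

instance (p : ℕ) : SecondCountableTopology (S p) := by
  have h1 : SecondCountableTopology (Matrix (Fin p) (Fin p) ℂ) :=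
    inferInstanceAs (SecondCountableTopology (Fin p → Fin p → ℂ))
  have h2 : SecondCountableTopology (Matrix (Fin p) (Fin p) ℂ)ᵐᵒᵖ :=
    (MulOpposite.opHomeomorph (M := Matrix (Fin p) (Fin p) ℂ)).symm.isEmbedding.secondCountableTopology
  have h3 : SecondCountableTopology (GL (Fin p) ℂ) :=
    Units.isEmbedding_embedProduct.secondCountableTopology
  exact Topology.IsEmbedding.subtypeVal.secondCountableTopology

/-- The matrix of an element of `S`. -/
abbrev mat {p : ℕ} (s : S p) : Matrix (Fin p) (Fin p) ℂ := (s : GL (Fin p) ℂ).val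

theorem mat_one {p : ℕ} : mat (1 : S p) = 1 := rfl

theorem mat_mul {p : ℕ} (s t : S p) : mat (s * t) = mat s * mat t := rfl

instance (p : ℕ) : TopologicalSpace.MetrizableSpace (S p) := by
  have h1 : TopologicalSpace.MetrizableSpace (Matrix (Fin p) (Fin p) ℂ) :=
    inferInstanceAs (TopologicalSpace.MetrizableSpace (Fin p → Fin p → ℂ))
  have h2 : TopologicalSpace.MetrizableSpace (Matrix (Fin p) (Fin p) ℂ)ᵐᵒᵖ :=
    (MulOpposite.opHomeomorph (M := Matrix (Fin p) (Fin p) ℂ)).symm.isEmbedding.metrizableSpace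
  have h3 : TopologicalSpace.MetrizableSpace (GL (Fin p) ℂ) :=
    Units.isEmbedding_embedProduct.metrizableSpace
  exact Topology.IsEmbedding.subtypeVal.metrizableSpace

/-- The space of complex `p × m` matrices. -/
abbrev Z (p m : ℕ) : Type := Fin p → Fin m → ℂ

/-- The matrix `z₁ z₂*`. -/
def mulStar {p m : ℕ} (z₁ z₂ : Z p m) : Matrix (Fin p) (Fin p) ℂ :=
  Matrix.of z₁ * (Matrix.of z₂)ᴴ

/-- The matrix `s z`. -/
def act {p m : ℕ} (s : S p) (z : Z p m) : Z p m :=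
  Matrix.of.symm (mat s * Matrix.of z)

/-- The Heisenberg group `N`: pairs `(n, z)` of a skew-Hermitian `p × p` matrix `n` and a complex
`p × m` matrix `z`. -/
@[ext]
structure N (p m : ℕ) where
  /-- the central component -/
  n : Matrix (Fin p) (Fin p) ℂ
  /-- the matrix component -/
  z : Z p m
  /-- the central component is skew-Hermitian -/
  skew : nᴴ = -n

section groupN

variable {p m : ℕ}

theorem mulStar_add_left (a b c : Z p m) : mulStar (a + b) c = mulStar a c + mulStar b c := by
  simp only [mulStar, ← Matrix.add_mul]
  rfl

theorem mulStar_add_right (a b c : Z p m) : mulStar a (b + c) = mulStar a b + mulStar a c := by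
  simp only [mulStar, ← Matrix.mul_add, ← Matrix.conjTranspose_add]
  rfl

theorem mulStar_neg_left (a b : Z p m) : mulStar (-a) b = -mulStar a b := by
  simp only [mulStar, ← Matrix.neg_mul]
  rfl

theorem conjTranspose_mulStar (a b : Z p m) : (mulStar a b)ᴴ = mulStar b a := by
  simp [mulStar]

theorem mulStar_zero_left (a : Z p m) : mulStar 0 a = 0 := by
  simpa using mulStar_add_left 0 0 a

theorem mulStar_zero_right (a : Z p m) : mulStar a 0 = 0 := by
  simpa using mulStar_add_right a 0 0

theorem act_add (s : S p) (a b : Z p m) : act s (a + b) = act s a + act s b := by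
  have h : Matrix.of (a + b) = Matrix.of a + Matrix.of b := rfl
  rw [act, h, Matrix.mul_add]
  rfl

theorem act_mul (s t : S p) (a : Z p m) : act (s * t) a = act s (act t a) := by
  simp [act, mat_mul, Matrix.mul_assoc]

theorem act_one (a : Z p m) : act 1 a = a := by
  simp [act, mat_one]

theorem mulStar_act (s : S p) (a b : Z p m) :
    mulStar (act s a) (act s b) =
      mat s * mulStar a b * (mat s)ᴴ := by
  simp [act, mulStar, Matrix.mul_assoc]

/-- The group law `(n₁,z₁)(n₂,z₂) = (n₁ + n₂ - ½ (z₁z₂* - z₂z₁*), z₁ + z₂)`. -/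
instance : Mul (N p m) where
  mul a b :=
    { n := a.n + b.n - (1 / 2 : ℂ) • (mulStar a.z b.z - mulStar b.z a.z)
      z := a.z + b.z
      skew := by
        simp only [Matrix.conjTranspose_sub, Matrix.conjTranspose_add, Matrix.conjTranspose_smul,
          conjTranspose_mulStar, a.skew, b.skew]
        have h : star (1 / 2 : ℂ) = 1 / 2 := by simp
        rw [h]
        module }

instance : One (N p m) where
  one := { n := 0, z := 0, skew := by simp }

instance : Inv (N p m) where
  inv a := { n := -a.n, z := -a.z, skew := by rw [Matrix.conjTranspose_neg, a.skew] }

@[simp] theorem mul_n (a b : N p m) :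
    (a * b).n = a.n + b.n - (1 / 2 : ℂ) • (mulStar a.z b.z - mulStar b.z a.z) := rfl
@[simp] theorem mul_z (a b : N p m) : (a * b).z = a.z + b.z := rfl
@[simp] theorem one_n : (1 : N p m).n = 0 := rfl
@[simp] theorem one_z : (1 : N p m).z = 0 := rfl
@[simp] theorem inv_n (a : N p m) : (a⁻¹).n = -a.n := rfl
@[simp] theorem inv_z (a : N p m) : (a⁻¹).z = -a.z := rfl

instance : Group (N p m) where
  mul_assoc a b c := by
    ext1
    · simp only [mul_n, mul_z, mulStar_add_left, mulStar_add_right]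
      module
    · simp only [mul_z, add_assoc]
  one_mul a := by
    ext1 <;> simp [mulStar_zero_left, mulStar_zero_right]
  mul_one a := by
    ext1 <;> simp [mulStar_zero_left, mulStar_zero_right]
  inv_mul_cancel a := by
    ext1
    · have h : mulStar a.z (-a.z) = -mulStar a.z a.z := by
        rw [← conjTranspose_mulStar, mulStar_neg_left, Matrix.conjTranspose_neg,
          conjTranspose_mulStar]
      simp [mulStar_neg_left, h]
    · simp

/-- The action `(n, z) ↦ (s n s*, s z)` of `s ∈ S` on `N`. -/
def conjN (s : S p) (g : N p m) : N p m where
  n := mat s * g.n * (mat s)ᴴ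
  z := act s g.z
  skew := by
    simp [Matrix.conjTranspose_mul, g.skew, Matrix.mul_assoc]

theorem conjN_one (g : N p m) : conjN 1 g = g := by
  ext1 <;> simp [conjN, act_one, mat_one]

theorem conjN_conjN (s t : S p) (g : N p m) : conjN (s * t) g = conjN s (conjN t g) := by
  ext1
  · simp [conjN, mat_mul, Matrix.mul_assoc]
  · simp [conjN, act_mul]

theorem conjN_mul (s : S p) (g h : N p m) : conjN s (g * h) = conjN s g * conjN s h := by
  ext1
  · simp only [conjN, mul_n, mulStar_act, Matrix.mul_sub, Matrix.sub_mul, Matrix.mul_add,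
      Matrix.add_mul, Matrix.mul_smul, Matrix.smul_mul]
  · simp [conjN, act_add]

/-- `S` acts on `N` by group automorphisms. -/
def autN (p m : ℕ) : S p →* MulAut (N p m) where
  toFun s :=
    { toFun := conjN s
      invFun := conjN s⁻¹
      left_inv := fun g => by rw [← conjN_conjN, inv_mul_cancel, conjN_one]
      right_inv := fun g => by rw [← conjN_conjN, mul_inv_cancel, conjN_one]
      map_mul' := conjN_mul s }
  map_one' := by
    ext1 g
    exact conjN_one g
  map_mul' s t := by
    ext1 g
    exact conjN_conjN s t g

/-- The Iwasawa group `P`: the semidirect product of `S` and `N`, with `s g s⁻¹ = (s n s*, s z)`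
for `s ∈ S` and `g = (n, z) ∈ N`. -/
abbrev P (p m : ℕ) : Type := N p m ⋊[autN p m] S p

end groupN

/-! ### The Bargmann spaces and the representations of `N` in them -/

section bargmann

variable {p m : ℕ}

/-- `tr z z*`. -/
def normSqZ (z : Z p m) : ℝ := ∑ i, ∑ j, ‖z i j‖ ^ 2

/-- The Gaussian measure `e^{- tr z z*} dz` on `Z`. -/
def gaussian (p m : ℕ) : Measure (Z p m) :=
  volume.withDensity fun z => ENNReal.ofReal (Real.exp (-normSqZ z))

/-- Complex conjugation of the rows `z_i` with `ε_i = -1`. -/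
def conjRows (ε : Fin p → ℤˣ) (z : Z p m) : Z p m :=
  fun i j => if ε i = 1 then z i j else conj (z i j)

/-- `h` is holomorphic in the rows `z_i` with `ε_i = 1` and antiholomorphic in the rows `z_i` with
`ε_i = -1`. -/
def IsHolomorphicOfType (ε : Fin p → ℤˣ) (h : Z p m → ℂ) : Prop :=
  Differentiable ℂ fun z => h (conjRows ε z)

/-- The Bargmann space `K^ε` of type `ε`, a subspace of `L²(Z, e^{- tr z z*} dz)`. -/
def bargmannSpace (m : ℕ) (ε : Fin p → ℤˣ) : Submodule ℂ (Lp ℂ 2 (gaussian p m)) where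
  carrier := {f | ∃ h : Z p m → ℂ, IsHolomorphicOfType ε h ∧ f =ᵐ[gaussian p m] h}
  add_mem' := by
    rintro f f' ⟨h, hh, hf⟩ ⟨h', hh', hf'⟩
    exact ⟨h + h', Differentiable.add hh hh', (Lp.coeFn_add f f').trans (hf.add hf')⟩
  zero_mem' := ⟨0, differentiable_const (0 : ℂ), Lp.coeFn_zero _ _ _⟩
  smul_mem' := by
    rintro c f ⟨h, hh, hf⟩
    exact ⟨c • h, Differentiable.const_smul hh c, (Lp.coeFn_smul c f).trans (hf.const_smul c)⟩

/-- The exponent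
`∑ᵢ (εᵢ nᵢᵢ - ½ zᵢ zᵢ*) - ∑_{εᵢ = 1} wᵢ zᵢ* - ∑_{εᵢ = -1} zᵢ wᵢ*`, for `g = (n, z)`. -/
def expo (ε : Fin p → ℤˣ) (g : N p m) (w : Z p m) : ℂ :=
  ∑ i, (((ε i : ℤ) : ℂ) * g.n i i - (1 / 2) * ∑ j, g.z i j * conj (g.z i j)
    - if ε i = 1 then ∑ j, w i j * conj (g.z i j) else ∑ j, g.z i j * conj (w i j))

/-- The formula `(T^ε(g) f)(w) = exp(expo ε g w) f(w + z)`, for `g = (n, z)`. -/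
def weyl (ε : Fin p → ℤˣ) (g : N p m) (f : Z p m → ℂ) (w : Z p m) : ℂ :=
  Complex.exp (expo ε g w) * f (w + g.z)

theorem re_diag (g : N p m) (i : Fin p) : (g.n i i).re = 0 := by
  have h := congrFun (congrFun g.skew i) i
  have h' := congrArg Complex.re h
  simp only [Matrix.conjTranspose_apply, Matrix.neg_apply, Complex.star_def, Complex.conj_re,
    Complex.neg_re] at h'
  linarith

theorem re_expo (ε : Fin p → ℤˣ) (g : N p m) (w : Z p m) :
    2 * (expo ε g w).re = normSqZ w - normSqZ (w + g.z) := by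
  simp only [expo, normSqZ, Complex.re_sum, ← Finset.sum_sub_distrib, Finset.mul_sum]
  refine Finset.sum_congr rfl fun i _ => ?_
  have h1 : (((ε i : ℤ) : ℂ) * g.n i i).re = 0 := by
    simp [re_diag]
  have h2 : ∀ x : ℂ, ‖x‖ ^ 2 = x.re ^ 2 + x.im ^ 2 := fun x => by
    rw [Complex.sq_norm, Complex.normSq_apply]; ring
  have h3 : ((1 / 2 : ℂ)).re = 1 / 2 ∧ ((1 / 2 : ℂ)).im = 0 := by constructor <;> simp
  rw [Complex.sub_re, Complex.sub_re, h1, Complex.re_sum]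
  have h4 : (if ε i = 1 then ∑ j, w i j * conj (g.z i j) else ∑ j, g.z i j * conj (w i j)).re
      = ∑ j, (w i j * conj (g.z i j)).re := by
    split_ifs
    · simp
    · rw [Complex.re_sum]
      refine Finset.sum_congr rfl fun j _ => ?_
      simp; ring
  rw [h4, zero_sub, neg_sub_left, mul_neg, ← Finset.sum_add_distrib, Finset.mul_sum,
    ← Finset.sum_neg_distrib]
  refine Finset.sum_congr rfl fun j _ => ?_
  simp only [Pi.add_apply, h2, Complex.mul_re, Complex.mul_im, Complex.conj_re, Complex.conj_im,
    Complex.add_re, Complex.add_im, h3.1, h3.2]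
  ring

theorem expo_one (ε : Fin p → ℤˣ) (w : Z p m) : expo ε 1 w = 0 := by
  simp [expo]

theorem expo_mul (ε : Fin p → ℤˣ) (g h : N p m) (w : Z p m) :
    expo ε (g * h) w = expo ε g w + expo ε h (w + g.z) := by
  simp only [expo, ← Finset.sum_add_distrib]
  refine Finset.sum_congr rfl fun i _ => ?_
  have e1 : ∀ a b : Z p m, mulStar a b i i = ∑ j, a i j * conj (b i j) := fun a b => by
    simp [mulStar, Matrix.mul_apply]
  simp only [mul_n, mul_z, Matrix.sub_apply, Matrix.add_apply, Matrix.smul_apply, smul_eq_mul, e1,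
    Pi.add_apply, map_add, mul_add, add_mul, Finset.sum_add_distrib]
  rcases Int.units_eq_one_or (ε i) with hε | hε
  · simp only [hε, if_true, Units.val_one, Int.cast_one]
    ring
  · have : (-1 : ℤˣ) ≠ 1 := by decide
    simp only [hε, this, if_false, Units.val_neg, Units.val_one, Int.cast_neg, Int.cast_one]
    ring

theorem continuous_expo {X : Type*} [TopologicalSpace X] (ε : Fin p → ℤˣ) {g : X → N p m}
    {w : X → Z p m} (hn : Continuous fun x => (g x).n) (hz : Continuous fun x => (g x).z)
    (hw : Continuous w) : Continuous fun x => expo ε (g x) (w x) := by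
  unfold expo
  refine continuous_finsetSum _ fun i _ => ?_
  have hn' : Continuous fun x => (g x).n i i := hn.matrix_elem i i
  by_cases h : ε i = 1
  · simp only [h, if_true]
    fun_prop
  · simp only [h, if_false]
    fun_prop

theorem continuous_normSqZ : Continuous (normSqZ : Z p m → ℝ) := by
  unfold normSqZ
  fun_prop

theorem norm_exp_expo (ε : Fin p → ℤˣ) (g : N p m) (w : Z p m) :
    ‖Complex.exp (expo ε g w)‖ ^ 2 * Real.exp (-normSqZ w) = Real.exp (-normSqZ (w + g.z)) := by
  rw [Complex.norm_exp, ← Real.exp_nat_mul, ← Real.exp_add]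
  congr 1
  have := re_expo ε g w
  push_cast
  linarith

theorem measurable_density :
    Measurable fun z : Z p m => ENNReal.ofReal (Real.exp (-normSqZ z)) :=
  (Real.continuous_exp.comp continuous_normSqZ.neg).measurable.ennreal_ofReal

theorem lintegral_gaussian (G : Z p m → ℝ≥0∞) :
    ∫⁻ w, G w ∂(gaussian p m) = ∫⁻ w, ENNReal.ofReal (Real.exp (-normSqZ w)) * G w := by
  rw [gaussian, lintegral_withDensity_eq_lintegral_mul_non_measurable _ measurable_density
    (Filter.Eventually.of_forall fun _ => ENNReal.ofReal_lt_top)]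
  rfl

theorem ae_gaussian : ae (gaussian p m) = ae (volume : Measure (Z p m)) := by
  refine le_antisymm ?_ ?_
  · exact (withDensity_absolutelyContinuous _ _).ae_le
  · refine (withDensity_absolutelyContinuous' measurable_density.aemeasurable ?_).ae_le
    exact Filter.Eventually.of_forall fun z => by
      simpa using Real.exp_pos _

theorem quasi_add (a : Z p m) :
    Measure.QuasiMeasurePreserving (fun w => w + a) (gaussian p m) (gaussian p m) := by
  have h := (measurePreserving_add_right (volume : Measure (Z p m)) a).quasiMeasurePreserving
  have h1 : gaussian p m ≪ volume := Measure.ae_le_iff_absolutelyContinuous.1 ae_gaussian.le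
  have h2 : volume ≪ gaussian p m := Measure.ae_le_iff_absolutelyContinuous.1 ae_gaussian.ge
  exact h.mono h1 h2

theorem lintegral_weyl (ε : Fin p → ℤˣ) (g : N p m) (f : Z p m → ℂ) :
    ∫⁻ w, ‖weyl ε g f w‖ₑ ^ (2 : ℝ) ∂(gaussian p m) = ∫⁻ w, ‖f w‖ₑ ^ (2 : ℝ) ∂(gaussian p m) := by
  rw [lintegral_gaussian, lintegral_gaussian,
    ← lintegral_add_right_eq_self (μ := (volume : Measure (Z p m)))
      (fun w => ENNReal.ofReal (Real.exp (-normSqZ w)) * ‖f w‖ₑ ^ (2 : ℝ)) g.z]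
  refine lintegral_congr fun w => ?_
  rw [weyl, enorm_mul, ENNReal.mul_rpow_of_nonneg _ _ (by norm_num), ← mul_assoc,
    ← norm_exp_expo ε g w, ENNReal.ofReal_mul (by positivity), mul_comm (ENNReal.ofReal _)]
  congr 2
  rw [← ofReal_norm, ENNReal.ofReal_rpow_of_nonneg (norm_nonneg _) (by norm_num)]
  norm_num

theorem eLpNorm_weyl (ε : Fin p → ℤˣ) (g : N p m) (f : Z p m → ℂ) :
    eLpNorm (weyl ε g f) 2 (gaussian p m) = eLpNorm f 2 (gaussian p m) := by
  rw [eLpNorm_eq_lintegral_rpow_enorm_toReal (by norm_num) (by norm_num),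
    eLpNorm_eq_lintegral_rpow_enorm_toReal (by norm_num) (by norm_num)]
  simp only [ENNReal.toReal_ofNat, lintegral_weyl]

theorem memLp_weyl (ε : Fin p → ℤˣ) (g : N p m) {f : Z p m → ℂ}
    (hf : MemLp f 2 (gaussian p m)) : MemLp (weyl ε g f) 2 (gaussian p m) := by
  refine ⟨?_, by rw [eLpNorm_weyl]; exact hf.2⟩
  refine AEStronglyMeasurable.mul ?_ (hf.1.comp_quasiMeasurePreserving (quasi_add g.z))
  exact (Complex.continuous_exp.comp
    (continuous_expo ε continuous_const continuous_const continuous_id)).aestronglyMeasurable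

theorem weyl_congr (ε : Fin p → ℤˣ) (g : N p m) {f f' : Z p m → ℂ}
    (h : f =ᵐ[gaussian p m] f') : weyl ε g f =ᵐ[gaussian p m] weyl ε g f' := by
  filter_upwards [(quasi_add g.z).ae h] with w hw
  simp only [weyl, hw]

theorem weyl_mul (ε : Fin p → ℤˣ) (g h : N p m) (f : Z p m → ℂ) :
    weyl ε g (weyl ε h f) = weyl ε (g * h) f := by
  funext w
  simp only [weyl, expo_mul, Complex.exp_add, mul_z, add_assoc, mul_assoc]

theorem weyl_one (ε : Fin p → ℤˣ) (f : Z p m → ℂ) : weyl ε 1 f = f := by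
  funext w
  simp [weyl, expo_one]

theorem isHolomorphicOfType_weyl (ε : Fin p → ℤˣ) (g : N p m) {h : Z p m → ℂ}
    (hh : IsHolomorphicOfType ε h) : IsHolomorphicOfType ε (weyl ε g h) := by
  have h1 : ∀ z : Z p m, conjRows ε z + g.z = conjRows ε (z + conjRows ε g.z) := by
    intro z
    funext i j
    simp only [conjRows, Pi.add_apply]
    split_ifs <;> simp
  have h2 : Differentiable ℂ fun z : Z p m => expo ε g (conjRows ε z) := by
    unfold expo
    refine Differentiable.fun_sum fun i _ => ?_
    by_cases hi : ε i = 1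
    · simp only [conjRows, hi, if_true]
      fun_prop
    · simp only [conjRows, hi, if_false, Complex.conj_conj]
      fun_prop
  refine Differentiable.mul h2.cexp ?_
  simp only [h1]
  exact Differentiable.comp (g := fun z => h (conjRows ε z)) hh
    (differentiable_id.add_const (conjRows ε g.z))

/-- The unitary operator `T^ε(g)`, `g ∈ N`, on `L²(Z, e^{- tr z z*} dz)`. -/
def weylOp (ε : Fin p → ℤˣ) (g : N p m) :
    Lp ℂ 2 (gaussian p m) →ₗᵢ[ℂ] Lp ℂ 2 (gaussian p m) where
  toFun f := (memLp_weyl ε g (Lp.memLp f)).toLp (weyl ε g f)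
  map_add' f f' := by
    rw [← MemLp.toLp_add]
    refine MemLp.toLp_congr _ _ ((weyl_congr ε g (Lp.coeFn_add f f')).trans ?_)
    refine Filter.Eventually.of_forall fun w => ?_
    simp only [weyl, Pi.add_apply, mul_add]
  map_smul' c f := by
    rw [RingHom.id_apply, ← MemLp.toLp_const_smul]
    refine MemLp.toLp_congr _ _ ((weyl_congr ε g (Lp.coeFn_smul c f)).trans ?_)
    refine Filter.Eventually.of_forall fun w => ?_
    simp only [weyl, Pi.smul_apply, smul_eq_mul, mul_left_comm]
  norm_map' f := by
    change ‖(memLp_weyl ε g (Lp.memLp f)).toLp (weyl ε g f)‖ = ‖f‖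
    rw [Lp.norm_toLp, eLpNorm_weyl, Lp.norm_def]

theorem weylOp_coeFn (ε : Fin p → ℤˣ) (g : N p m) (f : Lp ℂ 2 (gaussian p m)) :
    weylOp ε g f =ᵐ[gaussian p m] weyl ε g f :=
  MemLp.coeFn_toLp (memLp_weyl ε g (Lp.memLp f))

theorem weylOp_one (ε : Fin p → ℤˣ) (f : Lp ℂ 2 (gaussian p m)) : weylOp ε 1 f = f := by
  refine Lp.ext ((weylOp_coeFn ε 1 f).trans ?_)
  rw [weyl_one]

theorem weylOp_mul (ε : Fin p → ℤˣ) (g h : N p m) (f : Lp ℂ 2 (gaussian p m)) :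
    weylOp ε (g * h) f = weylOp ε g (weylOp ε h f) := by
  refine Lp.ext ((weylOp_coeFn ε _ f).trans ?_)
  rw [← weyl_mul]
  exact ((weylOp_coeFn ε g _).trans (weyl_congr ε g (weylOp_coeFn ε h f))).symm

theorem weylOp_mem (ε : Fin p → ℤˣ) (g : N p m) {f : Lp ℂ 2 (gaussian p m)}
    (hf : f ∈ bargmannSpace m ε) : weylOp ε g f ∈ bargmannSpace m ε := by
  obtain ⟨h, hh, hf⟩ := hf
  exact ⟨weyl ε g h, isHolomorphicOfType_weyl ε g hh,
    (weylOp_coeFn ε g f).trans (weyl_congr ε g hf)⟩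

/-- The representation `T^ε` of `N` in the Bargmann space `K^ε`. -/
def bargmannRep (m : ℕ) (ε : Fin p → ℤˣ) :
    N p m →* (bargmannSpace m ε →L[ℂ] bargmannSpace m ε) where
  toFun g := (weylOp ε g).toContinuousLinearMap.restrict fun _ hf => weylOp_mem ε g hf
  map_one' := by
    ext1 f
    exact Subtype.ext (weylOp_one ε f.1)
  map_mul' g h := by
    ext1 f
    exact Subtype.ext (weylOp_mul ε g h f.1)

/-- The conjugate representation `T_s^ε(g) = T^ε(g^s)`, `g^s = (s n s*, s z)`, of `N` in the
Bargmann space `K_s^ε`, whose elements are written as functions of the variable `w = s z`, in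
which `K_s^ε` is the space of functions of type `ε`. -/
def bargmannRepAt (m : ℕ) (ε : Fin p → ℤˣ) (s : S p) :
    N p m →* (bargmannSpace m ε →L[ℂ] bargmannSpace m ε) :=
  (bargmannRep m ε).comp (autN p m s).toMonoidHom

theorem bargmannRep_norm (ε : Fin p → ℤˣ) (g : N p m) (f : bargmannSpace m ε) :
    ‖bargmannRep m ε g f‖ = ‖f‖ :=
  (weylOp ε g).norm_map f

end bargmann

/-! ### The direct integral and the representations of `P` -/

section directIntegral

variable {p m : ℕ}

theorem gaussian_lt_top_of_isCompact {K : Set (Z p m)} (hK : IsCompact K) :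
    gaussian p m K < ∞ := by
  rw [← lintegral_indicator_one hK.measurableSet, lintegral_gaussian]
  calc ∫⁻ w, ENNReal.ofReal (Real.exp (-normSqZ w)) * K.indicator 1 w
      ≤ ∫⁻ w, K.indicator (1 : Z p m → ℝ≥0∞) w := by
        refine lintegral_mono fun w => ?_
        calc ENNReal.ofReal (Real.exp (-normSqZ w)) * K.indicator 1 w
            ≤ 1 * K.indicator 1 w := by
              gcongr
              rw [ENNReal.ofReal_le_one, Real.exp_le_one_iff, neg_nonpos]
              exact Finset.sum_nonneg fun i _ => Finset.sum_nonneg fun j _ => sq_nonneg _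
          _ = K.indicator 1 w := one_mul _
    _ = volume K := lintegral_indicator_one hK.measurableSet
    _ < ∞ := hK.measure_lt_top

instance : IsFiniteMeasureOnCompacts (gaussian p m) :=
  ⟨fun _ hK => gaussian_lt_top_of_isCompact hK⟩

theorem density_mul_weyl (ε : Fin p → ℤˣ) (g : N p m) (f : Z p m → ℂ) (w : Z p m) :
    Real.exp (-normSqZ w) * ‖weyl ε g f w‖ ^ 2 =
      Real.exp (-normSqZ (w + g.z)) * ‖f (w + g.z)‖ ^ 2 := by
  rw [weyl, norm_mul, mul_pow, ← norm_exp_expo ε g w]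
  ring

set_option maxHeartbeats 400000 in
theorem tendsto_weyl {X : Type*} [TopologicalSpace X] [FirstCountableTopology X]
    (ε : Fin p → ℤˣ) {g : X → N p m} (hn : Continuous fun x => (g x).n)
    (hz : Continuous fun x => (g x).z) {f : Z p m → ℂ} (hf : Continuous f)
    (hfc : HasCompactSupport f) (x₀ : X) :
    Filter.Tendsto (fun x => ∫⁻ w, ‖weyl ε (g x) f w - weyl ε (g x₀) f w‖ₑ ^ (2 : ℝ)
      ∂(gaussian p m)) (𝓝 x₀) (𝓝 0) := by
  simp only [lintegral_gaussian]
  obtain ⟨C, hC⟩ := hf.bounded_above_of_compact_support hfc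
  have hC0 : 0 ≤ C := (norm_nonneg _).trans (hC 0)
  obtain ⟨R, hR⟩ := hfc.isCompact.isBounded.subset_closedBall (0 : Z p m)
  have hzero : ∀ w : Z p m, R < ‖w‖ → f w = 0 := fun w hw => by
    by_contra h
    have := hR (subset_tsupport f h)
    rw [mem_closedBall_zero_iff] at this
    linarith
  have hcw : ∀ w, Continuous fun x => weyl ε (g x) f w := fun w =>
    (Complex.continuous_exp.comp (continuous_expo ε hn hz continuous_const)).mul
      (hf.comp (continuous_const.add hz))
  have hcx : ∀ x, Continuous (weyl ε (g x) f) := fun x =>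
    (Complex.continuous_exp.comp
      (continuous_expo ε continuous_const continuous_const continuous_id)).mul
      (hf.comp (continuous_id.add continuous_const))
  set B : Set (Z p m) := Metric.closedBall 0 (R + (‖(g x₀).z‖ + 1)) with hB
  have key : ∀ x, ‖(g x).z‖ ≤ ‖(g x₀).z‖ + 1 → ∀ w,
      Real.exp (-normSqZ w) * ‖weyl ε (g x) f w‖ ^ 2 ≤ B.indicator (fun _ => C ^ 2) w := by
    intro x hx w
    rw [density_mul_weyl]
    by_cases hw : w ∈ B
    · rw [Set.indicator_of_mem hw]
      have h1 : Real.exp (-normSqZ (w + (g x).z)) ≤ 1 := by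
        rw [Real.exp_le_one_iff, neg_nonpos]
        exact Finset.sum_nonneg fun i _ => Finset.sum_nonneg fun j _ => sq_nonneg _
      calc Real.exp (-normSqZ (w + (g x).z)) * ‖f (w + (g x).z)‖ ^ 2
          ≤ 1 * C ^ 2 := by
            gcongr
            exact hC _
        _ = C ^ 2 := one_mul _
    · rw [Set.indicator_of_notMem hw, hzero]
      · simp
      · rw [hB, mem_closedBall_zero_iff, not_le] at hw
        have := norm_le_norm_add_norm_sub' w (-(g x).z)
        rw [norm_neg, sub_neg_eq_add] at this
        linarith
  have hlim : (0 : ℝ≥0∞) = ∫⁻ _ : Z p m, 0 := by simp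
  rw [hlim]
  refine tendsto_lintegral_filter_of_dominated_convergence
    (fun w => ENNReal.ofReal (B.indicator (fun _ => 4 * C ^ 2) w)) ?_ ?_ ?_ ?_
  · refine Filter.Eventually.of_forall fun x => ?_
    refine measurable_density.mul (Measurable.pow_const (Measurable.enorm ?_) _)
    exact ((hcx x).sub (hcx x₀)).measurable
  · have h1 : ∀ᶠ x in 𝓝 x₀, ‖(g x).z‖ < ‖(g x₀).z‖ + 1 :=
      (hz.norm.tendsto x₀).eventually_lt_const (lt_add_one _)
    filter_upwards [h1] with x hx
    refine Filter.Eventually.of_forall fun w => ?_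
    have k1 := key x hx.le w
    have k2 := key x₀ (lt_add_one _).le w
    rw [← ofReal_norm, ENNReal.ofReal_rpow_of_nonneg (norm_nonneg _) (by norm_num),
      ← ENNReal.ofReal_mul (Real.exp_pos _).le]
    refine ENNReal.ofReal_le_ofReal ?_
    have h2 : ‖weyl ε (g x) f w - weyl ε (g x₀) f w‖ ^ (2 : ℝ) ≤
        2 * (‖weyl ε (g x) f w‖ ^ 2 + ‖weyl ε (g x₀) f w‖ ^ 2) := by
      have h3 := norm_sub_le (weyl ε (g x) f w) (weyl ε (g x₀) f w)
      have h4 := norm_nonneg (weyl ε (g x) f w - weyl ε (g x₀) f w)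
      rw [Real.rpow_two]
      nlinarith [sq_nonneg (‖weyl ε (g x) f w‖ - ‖weyl ε (g x₀) f w‖)]
    have h5 : B.indicator (fun _ => 4 * C ^ 2) w = 4 * B.indicator (fun _ => C ^ 2) w := by
      by_cases hw : w ∈ B <;> simp [hw]
    rw [h5]
    have h6 := mul_le_mul_of_nonneg_left h2 (Real.exp_pos (-normSqZ w)).le
    linarith
  · rw [← lt_top_iff_ne_top]
    have h1 : ∀ w, ENNReal.ofReal (B.indicator (fun _ => 4 * C ^ 2) w) =
        B.indicator (fun _ => ENNReal.ofReal (4 * C ^ 2)) w := fun w => by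
      by_cases hw : w ∈ B <;> simp [hw]
    simp only [h1]
    rw [lintegral_indicator_const Metric.isClosed_closedBall.measurableSet]
    exact ENNReal.mul_lt_top ENNReal.ofReal_lt_top (isCompact_closedBall _ _).measure_lt_top
  · refine Filter.Eventually.of_forall fun w => ?_
    have h1 : Filter.Tendsto (fun x => weyl ε (g x) f w - weyl ε (g x₀) f w) (𝓝 x₀) (𝓝 0) := by
      have := ((hcw w).sub (continuous_const (y := weyl ε (g x₀) f w))).tendsto x₀
      rwa [Pi.sub_apply, sub_self] at this
    have h2 : Filter.Tendsto
        (fun x => ‖weyl ε (g x) f w - weyl ε (g x₀) f w‖ₑ ^ (2 : ℝ)) (𝓝 x₀) (𝓝 0) := by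
      have h3 := (ENNReal.continuous_rpow_const (y := 2)).tendsto 0
      rw [ENNReal.zero_rpow_of_pos (by norm_num)] at h3
      refine h3.comp ?_
      simpa using h1.enorm
    have h4 := ENNReal.Tendsto.const_mul (a := ENNReal.ofReal (Real.exp (-normSqZ w))) h2
      (Or.inr ENNReal.ofReal_ne_top)
    simpa using h4

/-- Strong continuity of `T^ε`. -/
theorem continuous_weylOp {X : Type*} [TopologicalSpace X] [FirstCountableTopology X]
    (ε : Fin p → ℤˣ) {g : X → N p m} (hn : Continuous fun x => (g x).n)
    (hz : Continuous fun x => (g x).z) (f : Lp ℂ 2 (gaussian p m)) :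
    Continuous fun x => weylOp ε (g x) f := by
  refine continuous_of_uniform_approx_of_continuous fun u hu => ?_
  obtain ⟨δ, hδ, hu⟩ := Metric.mem_uniformity_dist.1 hu
  obtain ⟨f₀, hc, hle, hcont, hmem⟩ := (Lp.memLp f).exists_hasCompactSupport_eLpNorm_sub_le
    (by norm_num) (ε := ENNReal.ofReal (δ / 2)) (by simpa using half_pos hδ)
  refine ⟨fun x => weylOp ε (g x) (hmem.toLp f₀), ?_, fun x => hu ?_⟩
  · refine continuous_iff_continuousAt.2 fun x₀ => ?_
    rw [ContinuousAt, Lp.tendsto_Lp_iff_tendsto_eLpNorm']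
    have h1 : ∀ x, eLpNorm (⇑(weylOp ε (g x) (hmem.toLp f₀)) - ⇑(weylOp ε (g x₀) (hmem.toLp f₀)))
        2 (gaussian p m) = (∫⁻ w, ‖weyl ε (g x) f₀ w - weyl ε (g x₀) f₀ w‖ₑ ^ (2 : ℝ)
      ∂(gaussian p m)) ^ (1 / (2 : ℝ)) := by
      intro x
      have h2 : ∀ y, weylOp ε (g y) (hmem.toLp f₀) =ᵐ[gaussian p m] weyl ε (g y) f₀ := fun y =>
        (weylOp_coeFn ε (g y) _).trans (weyl_congr ε (g y) hmem.coeFn_toLp)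
      rw [eLpNorm_congr_ae ((h2 x).sub (h2 x₀)),
        eLpNorm_eq_lintegral_rpow_enorm_toReal (by norm_num) (by norm_num)]
      simp only [ENNReal.toReal_ofNat, Pi.sub_apply]
    simp only [h1]
    have h3 := (ENNReal.continuous_rpow_const (y := 1 / (2 : ℝ))).tendsto 0
    rw [ENNReal.zero_rpow_of_pos (by norm_num)] at h3
    exact h3.comp (tendsto_weyl ε hn hz hcont hc x₀)
  · rw [dist_eq_norm, ← map_sub, LinearIsometry.norm_map, Lp.norm_def]
    have h1 : eLpNorm (⇑(f - hmem.toLp f₀)) 2 (gaussian p m) ≤ ENNReal.ofReal (δ / 2) := by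
      rw [eLpNorm_congr_ae ((Lp.coeFn_sub f _).trans
        (Filter.EventuallyEq.rfl.sub hmem.coeFn_toLp))]
      exact hle
    have h2 := ENNReal.toReal_mono ENNReal.ofReal_ne_top h1
    rw [ENNReal.toReal_ofReal (half_pos hδ).le] at h2
    linarith

theorem continuous_mat : Continuous (mat : S p → Matrix (Fin p) (Fin p) ℂ) :=
  Units.continuous_val.comp continuous_subtype_val

theorem continuous_bargmannRepAt (ε : Fin p → ℤˣ) (g : N p m) :
    Continuous fun q : S p × bargmannSpace m ε => bargmannRepAt m ε q.1 g q.2 := by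
  have h1 : ∀ f : bargmannSpace m ε, Continuous fun s : S p => bargmannRepAt m ε s g f := by
    intro f
    refine Continuous.subtype_mk (f := fun s : S p => weylOp ε (conjN s g) f.1) ?_ _
    refine continuous_weylOp ε ?_ ?_ f.1
    · exact (continuous_mat.matrix_mul continuous_const).matrix_mul
        continuous_mat.matrix_conjTranspose
    · exact continuous_mat.matrix_mul continuous_const
  refine continuous_iff_continuousAt.2 fun q₀ => ?_
  have h2 : Filter.Tendsto (fun q : S p × bargmannSpace m ε => bargmannRepAt m ε q.1 g q₀.2)
      (𝓝 q₀) (𝓝 (bargmannRepAt m ε q₀.1 g q₀.2)) := ((h1 q₀.2).comp continuous_fst).tendsto q₀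
  have h3 : Filter.Tendsto (fun q : S p × bargmannSpace m ε =>
      bargmannRepAt m ε q.1 g (q.2 - q₀.2)) (𝓝 q₀) (𝓝 0) := by
    rw [tendsto_zero_iff_norm_tendsto_zero]
    have h4 : ∀ q : S p × bargmannSpace m ε,
        ‖bargmannRepAt m ε q.1 g (q.2 - q₀.2)‖ = ‖q.2 - q₀.2‖ :=
      fun q => bargmannRep_norm ε _ _
    simp only [h4]
    have h5 : Continuous fun q : S p × bargmannSpace m ε => ‖q.2 - q₀.2‖ := by fun_prop
    simpa using h5.tendsto q₀
  have h6 := h3.add h2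
  simp only [map_sub, sub_add_cancel, zero_add] at h6
  exact h6

/-- A measure `ν` on `S` is almost invariant if it is quasi-invariant under the right translations
`s ↦ s s₀` and the derivative `dν(s s₀) / dν(s)` is bounded for every `s₀ ∈ S`. Here `dν(s s₀)` is
the measure `E ↦ ν(E s₀)`, the image of `ν` under `s ↦ s s₀⁻¹`. -/
structure IsAlmostInvariant (ν : Measure (S p)) : Prop where
  /-- the translates of `ν` are absolutely continuous with respect to `ν` -/
  translate_ac : ∀ s₀ : S p, ν.map (fun s => s * s₀⁻¹) ≪ ν
  /-- `ν` is absolutely continuous with respect to its translates -/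
  ac_translate : ∀ s₀ : S p, ν ≪ ν.map (fun s => s * s₀⁻¹)
  /-- the derivatives are bounded -/
  bounded : ∀ s₀ : S p, ∃ C : ℝ≥0, ∀ᵐ s ∂ν, (ν.map fun s => s * s₀⁻¹).rnDeriv ν s ≤ C

theorem IsAlmostInvariant.exists_le {ν : Measure (S p)} [SigmaFinite ν]
    (hν : IsAlmostInvariant ν) (s₀ : S p) :
    ∃ C : ℝ≥0, ν.map (fun s => s * s₀) ≤ (C : ℝ≥0∞) • ν := by
  obtain ⟨C, hC⟩ := hν.bounded s₀⁻¹
  have hac := hν.translate_ac s₀⁻¹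
  rw [inv_inv] at hC hac
  refine ⟨C, ?_⟩
  have : SigmaFinite (ν.map fun s => s * s₀) :=
    (MeasurableEquiv.mulRight s₀).sigmaFinite_map
  rw [← Measure.withDensity_rnDeriv_eq _ _ hac, ← withDensity_const]
  exact withDensity_mono hC

/-- The isometry `f ↦ (a ↦ U a (f a))` of `L²(X, ν; E)` given by a continuous family of isometries
`U a` of `E`. -/
def fiberOp {X E : Type*} [TopologicalSpace X] [TopologicalSpace.MetrizableSpace X]
    [SecondCountableTopology X] [MeasurableSpace X] [OpensMeasurableSpace X]
    [NormedAddCommGroup E] [NormedSpace ℂ E] (ν : Measure X)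
    (U : X → E →L[ℂ] E) (hU : ∀ a v, ‖U a v‖ = ‖v‖) (hc : Continuous fun q : X × E => U q.1 q.2) :
    Lp E 2 ν →L[ℂ] Lp E 2 ν :=
  have hnorm : ∀ f : Lp E 2 ν, eLpNorm (fun a => U a (f a)) 2 ν = eLpNorm f 2 ν := fun f =>
    eLpNorm_congr_norm_ae (Filter.Eventually.of_forall fun _ => hU _ _)
  have hmem : ∀ f : Lp E 2 ν, MemLp (fun a => U a (f a)) 2 ν := fun f =>
    ⟨hc.comp_aestronglyMeasurable (aestronglyMeasurable_id.prodMk (Lp.aestronglyMeasurable f)),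
      by rw [hnorm]; exact Lp.eLpNorm_lt_top f⟩
  LinearIsometry.toContinuousLinearMap
    { toFun := fun f => (hmem f).toLp
      map_add' := fun f f' => by
        rw [← MemLp.toLp_add]
        refine MemLp.toLp_congr _ _ ?_
        filter_upwards [Lp.coeFn_add f f'] with s hs
        simp only [hs, Pi.add_apply, map_add]
      map_smul' := fun c f => by
        rw [RingHom.id_apply, ← MemLp.toLp_const_smul]
        refine MemLp.toLp_congr _ _ ?_
        filter_upwards [Lp.coeFn_smul c f] with s hs
        simp only [hs, Pi.smul_apply, map_smul]
      norm_map' := fun f => by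
        change ‖(hmem f).toLp‖ = ‖f‖
        rw [Lp.norm_toLp, hnorm, Lp.norm_def] }

theorem fiberOp_coeFn {X E : Type*} [TopologicalSpace X] [TopologicalSpace.MetrizableSpace X]
    [SecondCountableTopology X] [MeasurableSpace X] [OpensMeasurableSpace X] [NormedAddCommGroup E] [NormedSpace ℂ E]
    (ν : Measure X) (U : X → E →L[ℂ] E) (hU : ∀ a v, ‖U a v‖ = ‖v‖)
    (hc : Continuous fun q : X × E => U q.1 q.2) (f : Lp E 2 ν) :
    fiberOp ν U hU hc f =ᵐ[ν] fun a => U a (f a) :=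
  MemLp.coeFn_toLp (f := fun a => U a (f a))
    ⟨hc.comp_aestronglyMeasurable (aestronglyMeasurable_id.prodMk (Lp.aestronglyMeasurable f)),
      (eLpNorm_congr_norm_ae (Filter.Eventually.of_forall fun _ => hU _ _)).trans_lt
        (Lp.eLpNorm_lt_top f)⟩

/-- The bounded operator `f ↦ f ∘ τ` of `L²(X, ν; E)`, where the image of `ν` under `τ` is bounded
by a multiple of `ν`. -/
def compOp {X : Type*} (E : Type*) [MeasurableSpace X] [NormedAddCommGroup E] [NormedSpace ℂ E]
    {ν : Measure X} {τ : X → X} (hτ : Measurable τ)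
    (hC : ∃ C : ℝ≥0, ν.map τ ≤ (C : ℝ≥0∞) • ν) : Lp E 2 ν →L[ℂ] Lp E 2 ν :=
  have hq : Measure.QuasiMeasurePreserving τ ν ν :=
    ⟨hτ, hC.elim fun _ h => Measure.absolutelyContinuous_of_le_smul h⟩
  have hmem : ∀ f : Lp E 2 ν, MemLp (fun a => f (τ a)) 2 ν := fun f => by
    obtain ⟨C, hC⟩ := hC
    exact ((Lp.memLp f).of_measure_le_smul ENNReal.coe_ne_top hC).comp_of_map hτ.aemeasurable
  LinearMap.mkContinuousOfExistsBound
    { toFun := fun f => (hmem f).toLp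
      map_add' := fun f f' => by
        rw [← MemLp.toLp_add]
        refine MemLp.toLp_congr _ _ ?_
        filter_upwards [hq.ae (Lp.coeFn_add f f')] with s hs
        simp only [hs, Pi.add_apply]
      map_smul' := fun c f => by
        rw [RingHom.id_apply, ← MemLp.toLp_const_smul]
        refine MemLp.toLp_congr _ _ ?_
        filter_upwards [hq.ae (Lp.coeFn_smul c f)] with s hs
        simp only [hs, Pi.smul_apply] }
    (by
      obtain ⟨C, hC⟩ := hC
      refine ⟨((C : ℝ≥0∞) ^ (1 / (2 : ℝ))).toReal, fun f => ?_⟩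
      change ‖(hmem f).toLp‖ ≤ _
      rw [Lp.norm_toLp, Lp.norm_def, ← ENNReal.toReal_mul]
      refine ENNReal.toReal_mono (ENNReal.mul_ne_top ?_ (Lp.eLpNorm_ne_top f)) ?_
      · exact (ENNReal.rpow_lt_top_of_nonneg (by norm_num) ENNReal.coe_ne_top).ne
      have h1 : eLpNorm (fun a => f (τ a)) 2 ν = eLpNorm f 2 (ν.map τ) := by
        refine (eLpNorm_map_measure ?_ hτ.aemeasurable).symm
        exact ((Lp.memLp f).of_measure_le_smul ENNReal.coe_ne_top hC).1
      rw [h1]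
      have h2 := eLpNorm_le_of_measure_le_smul (p := 2) (f := f) hC
      simpa using h2)

theorem compOp_coeFn {X E : Type*} [MeasurableSpace X] [NormedAddCommGroup E] [NormedSpace ℂ E]
    {ν : Measure X} {τ : X → X} (hτ : Measurable τ)
    (hC : ∃ C : ℝ≥0, ν.map τ ≤ (C : ℝ≥0∞) • ν) (f : Lp E 2 ν) :
    compOp E hτ hC f =ᵐ[ν] fun a => f (τ a) :=
  MemLp.coeFn_toLp (f := fun a => f (τ a)) (hC.elim fun _ h =>
    ((Lp.memLp f).of_measure_le_smul ENNReal.coe_ne_top h).comp_of_map hτ.aemeasurable)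

/-- The direct integral over `S` of the Bargmann spaces `K_s^ε` with respect to `ν`: the Hilbert
space of square integrable sections `s ↦ f(s) ∈ K_s^ε`, where the elements of each `K_s^ε` are
written as functions of `w = s z`, which identifies `K_s^ε` with `K^ε`. -/
abbrev DirectIntegral (m : ℕ) (ε : Fin p → ℤˣ) (ν : Measure (S p)) : Type :=
  Lp (bargmannSpace m ε) 2 ν

/-- The unitary operator of `g ∈ N` in the direct integral: `(T_ε(g) f)(s) = T_s^ε(g) f(s)`. -/
def nOp (ε : Fin p → ℤˣ) (ν : Measure (S p)) (g : N p m) :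
    DirectIntegral m ε ν →L[ℂ] DirectIntegral m ε ν :=
  fiberOp ν (fun s => bargmannRepAt m ε s g) (fun _ _ => bargmannRep_norm ε _ _)
    (continuous_bargmannRepAt ε g)

theorem nOp_coeFn (ε : Fin p → ℤˣ) (ν : Measure (S p)) (g : N p m) (f : DirectIntegral m ε ν) :
    nOp ε ν g f =ᵐ[ν] fun s => bargmannRepAt m ε s g (f s) :=
  fiberOp_coeFn ν _ _ _ f

theorem quasi_mul {ν : Measure (S p)} (hν : IsAlmostInvariant ν) (s₀ : S p) :
    Measure.QuasiMeasurePreserving (fun s => s * s₀) ν ν :=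
  ⟨measurable_mul_const s₀, by simpa using hν.translate_ac s₀⁻¹⟩

/-- The bounded operator of `s₀ ∈ S` in the direct integral: `(T_ε(s₀) f)(s) = f(s s₀)`. -/
def sOp (m : ℕ) (ε : Fin p → ℤˣ) (ν : Measure (S p)) [SigmaFinite ν] (hν : IsAlmostInvariant ν)
    (s₀ : S p) : DirectIntegral m ε ν →L[ℂ] DirectIntegral m ε ν :=
  compOp (bargmannSpace m ε) (measurable_mul_const s₀) (hν.exists_le s₀)

theorem sOp_coeFn (ε : Fin p → ℤˣ) (ν : Measure (S p)) [SigmaFinite ν]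
    (hν : IsAlmostInvariant ν) (s₀ : S p) (f : DirectIntegral m ε ν) :
    sOp m ε ν hν s₀ f =ᵐ[ν] fun s => f (s * s₀) :=
  compOp_coeFn (measurable_mul_const s₀) (hν.exists_le s₀) f

/-- The representation `T_ε` of the Iwasawa group `P` in the direct integral of the Bargmann spaces
`K_s^ε` with respect to `ν`: the operator of `g s₀`, `g ∈ N`, `s₀ ∈ S`, is the product of the
operators of `g` and of `s₀`. -/
def iwasawaRep (m : ℕ) (ε : Fin p → ℤˣ) (ν : Measure (S p)) [SigmaFinite ν]
    (hν : IsAlmostInvariant ν) :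
    P p m →* (DirectIntegral m ε ν →L[ℂ] DirectIntegral m ε ν) where
  toFun x := nOp ε ν x.left * sOp m ε ν hν x.right
  map_one' := by
    ext1 f
    refine Lp.ext ((nOp_coeFn ε ν _ _).trans ?_)
    filter_upwards [sOp_coeFn ε ν hν 1 f] with s hs
    change bargmannRepAt m ε s 1 (sOp m ε ν hν 1 f s) = f s
    rw [hs, map_one, mul_one]
    rfl
  map_mul' x y := by
    ext1 f
    refine Lp.ext ((nOp_coeFn ε ν _ _).trans ?_)
    refine Filter.EventuallyEq.trans ?_ (nOp_coeFn ε ν _ _).symm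
    filter_upwards [sOp_coeFn ε ν hν (x.right * y.right) f,
      sOp_coeFn ε ν hν x.right ((nOp ε ν y.left * sOp m ε ν hν y.right) f),
      (quasi_mul hν x.right).ae (nOp_coeFn ε ν y.left (sOp m ε ν hν y.right f)),
      (quasi_mul hν x.right).ae (sOp_coeFn ε ν hν y.right f)] with s h1 h2 h3 h4
    change bargmannRepAt m ε s _ (sOp m ε ν hν (x.right * y.right) f s) =
      bargmannRepAt m ε s _ (sOp m ε ν hν x.right ((nOp ε ν y.left * sOp m ε ν hν y.right) f) s)
    have h5 : (nOp ε ν y.left * sOp m ε ν hν y.right) f =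
      nOp ε ν y.left (sOp m ε ν hν y.right f) := rfl
    rw [h1, h2, h5, h3, h4, SemidirectProduct.mul_left, map_mul, mul_assoc]
    have h6 : bargmannRepAt m ε s (autN p m x.right y.left) =
        bargmannRepAt m ε (s * x.right) y.left := by
      simp [bargmannRepAt, map_mul]
    rw [h6]
    rfl

end directIntegral

/-! ### Operator-irreducibility and equivalence -/

section representations

variable {G H H' : Type*} [Group G] [NormedAddCommGroup H] [NormedSpace ℂ H]
  [NormedAddCommGroup H'] [NormedSpace ℂ H']

/-- A representation by bounded operators in a nonzero space is operator-irreducible if every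
bounded operator that commutes with all its operators is a scalar operator. -/
def IsOperatorIrreducible (T : G →* (H →L[ℂ] H)) : Prop :=
  Nontrivial H ∧ ∀ A : H →L[ℂ] H, (∀ g, A * T g = T g * A) → ∃ c : ℂ, A = c • 1

/-- Two representations by bounded operators are equivalent if they are intertwined by a bounded
operator with bounded inverse. -/
def AreEquivalent (T : G →* (H →L[ℂ] H)) (T' : G →* (H' →L[ℂ] H')) : Prop :=
  ∃ A : H ≃L[ℂ] H', ∀ g f, A (T g f) = T' g (A f)

end representations

end Iwasawa

end

noncomputable section

namespace Iwasawa


/-! ### Integrability and rotation invariance for the Gaussian measure -/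

section gaussianMeasure

variable {p m : ℕ}

/-! The centre of `N` separates both the signs and the points of `S`. In the fibre over `s`, a
central element `(n, 0)` acts by the scalar `exp (tr (s* E s n))`, where `E = diag(ε)`, so the
centre acts through the characters of the Hermitian matrix `s* E s`. This matrix determines `ε` and
`s` (`formMat_injective`), because a lower triangular matrix equal to an upper triangular one is
diagonal, and the diagonal entries of elements of `S` are positive.

Let `A` be bounded and commute with the action of `N`. Pairing `A f` with a section `h` and putting
`k = A* h`, the complex measures `⟨k(s), f(s)⟩ dν` and `⟨h(s), A f(s)⟩ dν'`, carried to the space of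
matrices by `s ↦ s* E s` and `s ↦ s* E' s`, have the same Fourier transform, hence coincide
(`setIntegral_preimage_eq`). If `ε ≠ ε'`, the images of `S` are disjoint, so both measures vanish
and `A = 0`; this is (ii).

If `ε = ε'` and `ν = ν'`, the map `s ↦ s* E s` is a Borel embedding, and the equality of measures
becomes the pointwise identity `⟨k(s), f(s)⟩ = ⟨h(s), A f(s)⟩`. No decomposition of `A` into
operators in the fibres is needed. Instead, `h` is taken to be a section `Ψ = φ · 1` of positive
multiples of the vacuum, the constant function 1. The function `z ↦ ⟨1, T(0,z) f⟩` is, up to a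
nonvanishing Gaussian factor, `f` itself (`inner_vacuum_bargmannRep`, from the mean value property).
For `f = Ψ` the identity says that a function of type `ε` equals the complex conjugate of one
evaluated at `-z`; such a function is constant, so `k(s)` is a multiple of the vacuum
(`eq_smul_vacuum`). For general `f` it then says `A f(s) = c(s) f(s)`, by cyclicity of the vacuum
(`exists_measurable_multiplier`).

Finally, commuting with the translations by `S` makes `c` invariant under every translation almost
everywhere, and Fubini's theorem makes it constant (`exists_ae_eq_const`). Only the operators of `N`
have to be unitary in this argument; those of `S` enter solely through quasi-invariance. -/

theorem sq_norm_le_normSqZ (w : Z p m) : ‖w‖ ^ 2 ≤ normSqZ w := by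
  have h1 : ‖w‖ ≤ √(normSqZ w) := by
    refine (pi_norm_le_iff_of_nonneg (Real.sqrt_nonneg _)).2 fun i =>
      (pi_norm_le_iff_of_nonneg (Real.sqrt_nonneg _)).2 fun j => Real.le_sqrt_of_sq_le ?_
    calc ‖w i j‖ ^ 2 ≤ ∑ j, ‖w i j‖ ^ 2 :=
          Finset.single_le_sum (f := fun j => ‖w i j‖ ^ 2) (fun _ _ => sq_nonneg _)
            (Finset.mem_univ j)
      _ ≤ normSqZ w := Finset.single_le_sum (f := fun i => ∑ j, ‖w i j‖ ^ 2)
            (fun _ _ => Finset.sum_nonneg fun _ _ => sq_nonneg _) (Finset.mem_univ i)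
  have h0 : 0 ≤ normSqZ w := Finset.sum_nonneg fun _ _ => Finset.sum_nonneg fun _ _ => sq_nonneg _
  calc ‖w‖ ^ 2 ≤ √(normSqZ w) ^ 2 := by gcongr
    _ = normSqZ w := Real.sq_sqrt h0

theorem integrable_exp_neg_half_normSqZ :
    Integrable (fun w : Z p m => Real.exp (-(1 / 2) * normSqZ w)) := by
  have h0 : Integrable (fun x : ℂ => Real.exp (-(1 / 2) * ‖x‖ ^ 2)) := by
    have := (GaussianFourier.integrable_cexp_neg_mul_sq_norm_add (V := ℂ) (b := 1 / 2)
      (by norm_num) 0 0).norm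
    refine this.congr (Filter.Eventually.of_forall fun x => ?_)
    simp only [Complex.norm_exp]
    congr 1
    simp [← Complex.ofReal_pow]
  have h1 : Integrable (fun x : Fin m → ℂ => ∏ j, Real.exp (-(1 / 2) * ‖x j‖ ^ 2)) :=
    Integrable.fintype_prod (f := fun _ x => Real.exp (-(1 / 2) * ‖x‖ ^ 2)) fun _ => h0
  have h2 : Integrable (fun w : Z p m => ∏ i, ∏ j, Real.exp (-(1 / 2) * ‖w i j‖ ^ 2)) :=
    Integrable.fintype_prod
      (f := fun _ x => ∏ j, Real.exp (-(1 / 2) * ‖(x : Fin m → ℂ) j‖ ^ 2)) fun _ => h1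
  refine h2.congr (Filter.Eventually.of_forall fun w => ?_)
  simp only [← Real.exp_sum, normSqZ, Finset.mul_sum]

theorem integrable_gaussian_iff {E : Type*} [NormedAddCommGroup E] [NormedSpace ℝ E]
    {f : Z p m → E} :
    Integrable f (gaussian p m) ↔ Integrable fun w => Real.exp (-normSqZ w) • f w := by
  rw [gaussian, integrable_withDensity_iff_integrable_smul₀' measurable_density.aemeasurable
    (Filter.Eventually.of_forall fun _ => ENNReal.ofReal_lt_top)]
  simp only [ENNReal.toReal_ofReal (Real.exp_pos _).le]

theorem memLp_exp_mul_norm (c : ℝ) :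
    MemLp (fun w : Z p m => Real.exp (c * ‖w‖)) 2 (gaussian p m) := by
  have hc : Continuous fun w : Z p m => Real.exp (c * ‖w‖) := by fun_prop
  rw [memLp_two_iff_integrable_sq hc.aestronglyMeasurable, integrable_gaussian_iff]
  -- The constant comes from `2c‖w‖ ≤ ‖w‖²/2 + 2c²`, that is, from `(‖w‖ - 2c)² ≥ 0`; half of the
  -- Gaussian decay remains for integrability.
  refine (integrable_exp_neg_half_normSqZ.const_mul (Real.exp (2 * c ^ 2))).mono' ?_ ?_
  · exact (((Real.continuous_exp.comp continuous_normSqZ.neg)).smul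
      (hc.pow 2)).aestronglyMeasurable
  · refine Filter.Eventually.of_forall fun w => ?_
    rw [Real.norm_of_nonneg (smul_nonneg (Real.exp_pos _).le (sq_nonneg _)), smul_eq_mul,
      ← Real.exp_nat_mul, ← Real.exp_add, ← Real.exp_add]
    refine Real.exp_le_exp.2 ?_
    have := sq_norm_le_normSqZ w
    push_cast
    nlinarith [sq_nonneg (‖w‖ - 2 * c)]

instance isFiniteMeasure_gaussian : IsFiniteMeasure (gaussian p m) := by
  have h := (memLp_exp_mul_norm (p := p) (m := m) 0).integrable_sq
  simp only [zero_mul, Real.exp_zero, one_pow] at h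
  exact (integrable_const_iff_isFiniteMeasure one_ne_zero).1 h

/-- The total mass of the Gaussian measure. -/
def gaussianMass (p m : ℕ) : ℝ := (gaussian p m).real Set.univ

instance isOpenPosMeasure_volume : (volume : Measure (Z p m)).IsOpenPosMeasure := by
  have : (volume : Measure (Fin m → ℂ)).IsOpenPosMeasure :=
    inferInstanceAs (Measure.pi fun _ : Fin m => (volume : Measure ℂ)).IsOpenPosMeasure
  exact inferInstanceAs
    (Measure.pi fun _ : Fin p => (volume : Measure (Fin m → ℂ))).IsOpenPosMeasure

theorem gaussianMass_ne_zero : gaussianMass p m ≠ 0 := by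
  have h : gaussian p m ≠ 0 := by
    intro h
    have h1 := ae_gaussian (p := p) (m := m)
    rw [h, ae_zero] at h1
    exact (isOpen_univ.measure_pos (volume : Measure (Z p m)) Set.univ_nonempty).ne'
      (by rw [ae_eq_bot.1 h1.symm]; rfl)
  rw [gaussianMass, measureReal_def, ENNReal.toReal_ne_zero]
  exact ⟨by simpa using h, measure_ne_top _ _⟩

/-- Multiplication of the entries by numbers of modulus one preserves the Gaussian measure. -/
theorem measurePreserving_rotate (u : Fin p → Circle) :
    MeasurePreserving (fun (w : Z p m) i j => (u i : ℂ) * w i j) (gaussian p m)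
      (gaussian p m) := by
  have h1 : MeasurePreserving (fun (w : Z p m) i j => (u i : ℂ) * w i j) :=
    volume_preserving_pi fun i => volume_preserving_pi fun _ =>
      (rotation (u i)).measurePreserving
  have h2 : ∀ w : Z p m, normSqZ (fun i j => (u i : ℂ) * w i j) = normSqZ w := fun w => by
    simp only [normSqZ, norm_mul, Circle.norm_coe, one_mul]
  refine ⟨h1.measurable, ?_⟩
  ext s hs
  rw [Measure.map_apply h1.measurable hs, ← lintegral_indicator_one (h1.measurable hs),
    ← lintegral_indicator_one hs, lintegral_gaussian, lintegral_gaussian]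
  have hm : Measurable fun w : Z p m => ENNReal.ofReal (Real.exp (-normSqZ w)) *
      s.indicator 1 w := measurable_density.mul (measurable_one.indicator hs)
  rw [← h1.lintegral_comp hm]
  simp only [h2]
  rfl

end gaussianMeasure

/-! ### The mean value property of functions of type `ε` -/

section meanValue

variable {p m : ℕ}

theorem conjRows_conjRows (ε : Fin p → ℤˣ) (z : Z p m) : conjRows ε (conjRows ε z) = z := by
  funext i j
  simp only [conjRows]
  split_ifs <;> simp

theorem continuous_conjRows (ε : Fin p → ℤˣ) : Continuous (conjRows ε : Z p m → Z p m) := by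
  refine continuous_pi fun i => continuous_pi fun j => ?_
  unfold conjRows
  split_ifs
  · fun_prop
  · fun_prop

theorem IsHolomorphicOfType.continuous {ε : Fin p → ℤˣ} {h : Z p m → ℂ}
    (hh : IsHolomorphicOfType ε h) : Continuous h := by
  have := (Differentiable.continuous hh).comp (continuous_conjRows ε)
  simpa [Function.comp_def, conjRows_conjRows] using this

/-- The rotation `w_i ↦ e^{i ε_i θ} w_i`. -/
def rotateRows (ε : Fin p → ℤˣ) (θ : ℝ) (w : Z p m) : Z p m :=
  fun i j => ((Circle.exp (((ε i : ℤ) : ℝ) * θ) : Circle) : ℂ) * w i j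

/-- The antiholomorphic rows are rotated backwards so that, after conjugating them, the rotation
becomes multiplication by one complex number of modulus 1. -/
theorem rotateRows_eq (ε : Fin p → ℤˣ) (θ : ℝ) (w : Z p m) :
    rotateRows ε θ w = conjRows ε (circleMap 0 1 θ • conjRows ε w) := by
  funext i j
  rcases Int.units_eq_one_or (ε i) with hε | hε
  · simp [rotateRows, conjRows, hε, circleMap]
  · have : (-1 : ℤˣ) ≠ 1 := by decide
    simp [rotateRows, conjRows, hε, this, circleMap, ← Complex.exp_conj, Complex.exp_neg]

theorem continuous_rotateRows (ε : Fin p → ℤˣ) :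
    Continuous fun q : ℝ × Z p m => rotateRows ε q.1 q.2 := by
  unfold rotateRows
  fun_prop

theorem measurePreserving_rotateRows (ε : Fin p → ℤˣ) (θ : ℝ) :
    MeasurePreserving (rotateRows (m := m) ε θ) (gaussian p m) (gaussian p m) :=
  measurePreserving_rotate fun i => Circle.exp (((ε i : ℤ) : ℝ) * θ)

/-- The orbit of `w` is the unit circle in a complex line on which `h` restricts to an entire
function of one variable, so Cauchy's mean value formula applies. -/
theorem integral_rotateRows {ε : Fin p → ℤˣ} {h : Z p m → ℂ} (hh : IsHolomorphicOfType ε h)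
    (w : Z p m) : ∫ θ in (0 : ℝ)..2 * Real.pi, h (rotateRows ε θ w) = (2 * Real.pi : ℝ) • h 0 := by
  have hd : Differentiable ℂ fun t : ℂ => h (conjRows ε (t • conjRows ε w)) :=
    Differentiable.comp (g := fun z => h (conjRows ε z)) hh
      (differentiable_id.smul_const (conjRows ε w))
  have h1 := circleAverage_of_differentiable_on_off_countable (c := 0) (R := 1)
    Set.countable_empty hd.continuous.continuousOn fun z _ => hd z
  rw [Real.circleAverage] at h1
  have h2 : conjRows ε (0 : Z p m) = 0 := by
    funext i j
    simp [conjRows]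
  simp only [zero_smul, h2] at h1
  simp only [rotateRows_eq]
  rw [← h1, smul_smul, mul_inv_cancel₀ Real.two_pi_pos.ne', one_smul]

/-- The mean value property of the functions of type `ε`. -/
theorem integral_gaussian_of_type {ε : Fin p → ℤˣ} {h : Z p m → ℂ}
    (hh : IsHolomorphicOfType ε h) (hi : Integrable h (gaussian p m)) :
    ∫ w, h w ∂(gaussian p m) = gaussianMass p m * h 0 := by
  -- The double integral of `h` over angles and Gaussian points is computed in both orders: rotation
  -- invariance of the Gaussian measure gives the left side, the mean value over circles gives the
  -- right.
  set μ : Measure ℝ := volume.restrict (Set.uIoc 0 (2 * Real.pi)) with hμ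
  have hcont : Continuous fun q : ℝ × Z p m => h (rotateRows ε q.1 q.2) :=
    hh.continuous.comp (continuous_rotateRows ε)
  have hrot : ∀ θ, ∫ w, h (rotateRows ε θ w) ∂(gaussian p m) = ∫ w, h w ∂(gaussian p m) := by
    intro θ
    have hm := measurePreserving_rotateRows (m := m) ε θ
    conv_rhs => rw [← hm.map_eq]
    exact (integral_map hm.measurable.aemeasurable hh.continuous.aestronglyMeasurable).symm
  have hnorm : ∀ θ, ∫ w, ‖h (rotateRows ε θ w)‖ ∂(gaussian p m) =
      ∫ w, ‖h w‖ ∂(gaussian p m) := by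
    intro θ
    have hm := measurePreserving_rotateRows (m := m) ε θ
    conv_rhs => rw [← hm.map_eq]
    exact (integral_map hm.measurable.aemeasurable hh.continuous.norm.aestronglyMeasurable).symm
  have hint : Integrable (Function.uncurry fun θ w => h (rotateRows ε θ w))
      (μ.prod (gaussian p m)) := by
    refine (integrable_prod_iff hcont.aestronglyMeasurable).2 ⟨?_, ?_⟩
    · refine Filter.Eventually.of_forall fun θ => ?_
      exact (measurePreserving_rotateRows ε θ).integrable_comp_of_integrable hi
    · simp only [hnorm]
      have : IsFiniteMeasure μ := ⟨by
        rw [hμ, Measure.restrict_apply_univ, Set.uIoc, Real.volume_Ioc]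
        exact ENNReal.ofReal_lt_top⟩
      exact integrable_const _
  have hswap := intervalIntegral_integral_swap (f := fun θ w => h (rotateRows ε θ w)) hint
  simp only [hrot, integral_rotateRows hh, intervalIntegral.integral_const, integral_const,
    sub_zero] at hswap
  rw [smul_comm] at hswap
  have h2 := smul_right_injective ℂ Real.two_pi_pos.ne' hswap
  rw [h2, gaussianMass, Complex.real_smul]

end meanValue


/-! ### Laplace transforms with respect to the Gaussian measure -/

section laplace

variable {p m : ℕ}

/-- The bilinear form `∑ c_ij ζ_ij`, as a linear form in `ζ`. -/
def pairing (c : Z p m) : Z p m →L[ℂ] ℂ :=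
  ∑ i, ∑ j, c i j • (ContinuousLinearMap.proj (R := ℂ) (φ := fun _ : Fin m => ℂ) j).comp
    (ContinuousLinearMap.proj (R := ℂ) (φ := fun _ : Fin p => Fin m → ℂ) i)

theorem pairing_apply (c ζ : Z p m) : pairing c ζ = ∑ i, ∑ j, c i j * ζ i j := by
  simp [pairing]

theorem continuous_pairing : Continuous (pairing : Z p m → Z p m →L[ℂ] ℂ) := by
  unfold pairing
  fun_prop

theorem norm_pairing_le (c : Z p m) : ‖pairing c‖ ≤ (p * m : ℝ) * ‖c‖ := by
  refine ContinuousLinearMap.opNorm_le_bound _ (by positivity) fun ζ => ?_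
  rw [pairing_apply]
  have h : ∀ i j, ‖c i j * ζ i j‖ ≤ ‖c‖ * ‖ζ‖ := fun i j => by
    rw [norm_mul]
    gcongr
    · exact (norm_le_pi_norm (c i) j).trans (norm_le_pi_norm c i)
    · exact (norm_le_pi_norm (ζ i) j).trans (norm_le_pi_norm ζ i)
  calc ‖∑ i, ∑ j, c i j * ζ i j‖ ≤ ∑ _i : Fin p, ∑ _j : Fin m, ‖c‖ * ‖ζ‖ :=
        (norm_sum_le _ _).trans (Finset.sum_le_sum fun i _ =>
          (norm_sum_le _ _).trans (Finset.sum_le_sum fun j _ => h i j))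
    _ = p * m * ‖c‖ * ‖ζ‖ := by
        simp
        ring

/-- The Laplace transform of a square integrable function with respect to the Gaussian measure is
an entire function. -/
theorem differentiable_laplace {ω : Z p m → Z p m} (hω : Continuous ω) (hn : ∀ w, ‖ω w‖ ≤ ‖w‖)
    {f : Z p m → ℂ} (hf : MemLp f 2 (gaussian p m)) :
    Differentiable ℂ fun ζ => ∫ w, Complex.exp (pairing (ω w) ζ) * f w ∂(gaussian p m) := by
  intro ζ₀
  set D : ℝ := p * m with hD
  have hD0 : 0 ≤ D := by positivity
  set R : ℝ := ‖ζ₀‖ + 1 with hR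
  have hexp : ∀ ζ w, ‖Complex.exp (pairing (ω w) ζ)‖ ≤ Real.exp (D * ‖ζ‖ * ‖w‖) := fun ζ w => by
    rw [Complex.norm_exp]
    refine Real.exp_le_exp.2 ((Complex.re_le_norm _).trans ?_)
    calc ‖pairing (ω w) ζ‖ ≤ ‖pairing (ω w)‖ * ‖ζ‖ := (pairing (ω w)).le_opNorm ζ
      _ ≤ D * ‖w‖ * ‖ζ‖ := by
        gcongr
        exact (norm_pairing_le _).trans (by gcongr; exact hn w)
      _ = D * ‖ζ‖ * ‖w‖ := by ring
  have hcont : ∀ ζ, Continuous fun w => Complex.exp (pairing (ω w) ζ) := fun ζ =>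
    Complex.continuous_exp.comp ((continuous_pairing.comp hω).clm_apply continuous_const)
  have hpc : Continuous fun w => pairing (ω w) := continuous_pairing.comp hω
  have hb : ∀ c : ℝ, Integrable (fun w => Real.exp (c * ‖w‖) * ‖f w‖) (gaussian p m) := fun c =>
    (memLp_exp_mul_norm c).integrable_mul hf.norm
  -- Differentiation under the integral on the unit ball around `ζ₀`, where `‖ζ‖ ≤ R`. The factor
  -- `‖w‖` produced by the derivative is absorbed by `‖w‖ ≤ exp ‖w‖`, whence the `+ 1` in the
  -- exponent of the bound.
  refine (hasFDerivAt_integral_of_dominated_of_fderiv_le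
    (F' := fun ζ w => (Complex.exp (pairing (ω w) ζ) * f w) • pairing (ω w))
    (bound := fun w => D * (Real.exp ((D * R + 1) * ‖w‖) * ‖f w‖))
    (Metric.ball_mem_nhds ζ₀ one_pos) ?_ ?_ ?_ ?_ ?_ ?_).differentiableAt
  · exact Filter.Eventually.of_forall fun ζ => (hcont ζ).aestronglyMeasurable.mul hf.1
  · refine (hb (D * ‖ζ₀‖)).mono' ((hcont ζ₀).aestronglyMeasurable.mul hf.1) ?_
    refine Filter.Eventually.of_forall fun w => ?_
    rw [norm_mul]
    gcongr
    exact hexp ζ₀ w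
  · exact ((hcont ζ₀).aestronglyMeasurable.mul hf.1).smul hpc.aestronglyMeasurable
  · refine Filter.Eventually.of_forall fun w ζ hζ => ?_
    have h1 : ‖ζ‖ ≤ R := by
      have := norm_le_norm_add_norm_sub' ζ ζ₀
      rw [Metric.mem_ball, dist_eq_norm] at hζ
      linarith
    rw [norm_smul, norm_mul]
    have h2 : ‖pairing (ω w)‖ ≤ D * Real.exp ‖w‖ := by
      refine (norm_pairing_le _).trans ?_
      gcongr
      linarith [hn w, Real.add_one_le_exp ‖w‖]
    have h3 : ‖Complex.exp (pairing (ω w) ζ)‖ ≤ Real.exp (D * R * ‖w‖) :=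
      (hexp ζ w).trans (by gcongr)
    calc ‖Complex.exp (pairing (ω w) ζ)‖ * ‖f w‖ * ‖pairing (ω w)‖
        ≤ Real.exp (D * R * ‖w‖) * ‖f w‖ * (D * Real.exp ‖w‖) := by gcongr
      _ = D * (Real.exp ((D * R + 1) * ‖w‖) * ‖f w‖) := by
        rw [add_mul, one_mul, Real.exp_add]
        ring
  · exact (hb _).const_mul D
  · refine Filter.Eventually.of_forall fun w ζ _ => ?_
    have := ((pairing (ω w)).hasFDerivAt (x := ζ)).cexp.mul_const (f w)
    refine this.congr_fderiv ?_
    rw [smul_smul, mul_comm]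

end laplace

/-! ### The Bargmann space: coherent states, completeness, the vacuum -/

section fiber

variable {p m : ℕ}

/-- The element `(0, z)` of `N`. -/
def heis (z : Z p m) : N p m := ⟨0, z, by simp⟩

theorem heis_inv (z : Z p m) : (heis z)⁻¹ = heis (-z) := by
  ext1 <;> simp [heis]

/-- The constant function `1`, as an element of the Bargmann space. -/
def vacuum (m : ℕ) (ε : Fin p → ℤˣ) : bargmannSpace m ε :=
  ⟨(memLp_const (1 : ℂ)).toLp, fun _ => 1, differentiable_const (1 : ℂ), MemLp.coeFn_toLp (memLp_const 1)⟩

theorem vacuum_coeFn (ε : Fin p → ℤˣ) :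
    (vacuum m ε : Lp ℂ 2 (gaussian p m)) =ᵐ[gaussian p m] fun _ => 1 :=
  MemLp.coeFn_toLp (memLp_const 1)

theorem inner_vacuum {ε : Fin p → ℤˣ} (f : bargmannSpace m ε) {h : Z p m → ℂ}
    (hh : IsHolomorphicOfType ε h) (hf : f.1 =ᵐ[gaussian p m] h) :
    inner ℂ (vacuum m ε) f = gaussianMass p m * h 0 := by
  have hi : Integrable h (gaussian p m) :=
    ((Lp.memLp f.1).integrable (by norm_num)).congr hf
  rw [← integral_gaussian_of_type hh hi, Submodule.coe_inner, L2.inner_def]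
  refine integral_congr_ae ?_
  filter_upwards [vacuum_coeFn (m := m) ε, hf] with w h1 h2
  rw [h1, h2]
  simp

theorem expo_heis_zero (ε : Fin p → ℤˣ) (z : Z p m) :
    expo ε (heis z) 0 = ((-(1 / 2) * normSqZ z : ℝ) : ℂ) := by
  simp only [expo, heis, normSqZ, Complex.mul_conj, Complex.normSq_eq_norm_sq]
  push_cast
  simp [Finset.mul_sum]

theorem bargmannRep_coeFn (ε : Fin p → ℤˣ) (g : N p m) (f : bargmannSpace m ε) {h : Z p m → ℂ}
    (hf : f.1 =ᵐ[gaussian p m] h) :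
    (bargmannRep m ε g f).1 =ᵐ[gaussian p m] weyl ε g h :=
  (weylOp_coeFn ε g f.1).trans (weyl_congr ε g hf)

/-- The reproducing property. Pairing with 1 evaluates at the origin, and `T(0,z)` moves the value
at `z` there with the factor `exp (-|z|²/2)`. Matrix coefficients with the vacuum thus recover the
function. -/
theorem inner_vacuum_bargmannRep {ε : Fin p → ℤˣ} (f : bargmannSpace m ε) {h : Z p m → ℂ}
    (hh : IsHolomorphicOfType ε h) (hf : f.1 =ᵐ[gaussian p m] h) (z : Z p m) :
    inner ℂ (vacuum m ε) (bargmannRep m ε (heis z) f) =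
      gaussianMass p m * (Real.exp (-(1 / 2) * normSqZ z) * h z) := by
  rw [inner_vacuum _ (isHolomorphicOfType_weyl ε (heis z) hh) (bargmannRep_coeFn ε _ f hf), weyl,
    expo_heis_zero, ← Complex.ofReal_exp, zero_add]
  rfl

theorem inner_bargmannRep {ε : Fin p → ℤˣ} (g : N p m) (a b : bargmannSpace m ε) :
    inner ℂ (bargmannRep m ε g a) (bargmannRep m ε g b) = inner ℂ a b :=
  (weylOp ε g).inner_map_map a.1 b.1

theorem inner_bargmannRep_right {ε : Fin p → ℤˣ} (g : N p m) (a b : bargmannSpace m ε) :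
    inner ℂ a (bargmannRep m ε g b) = inner ℂ (bargmannRep m ε g⁻¹ a) b := by
  rw [← inner_bargmannRep g (bargmannRep m ε g⁻¹ a), ← mul_apply_eq_comp, ← map_mul,
    mul_inv_cancel, map_one]
  rfl

/-- The vacuum is a cyclic vector. -/
theorem eq_zero_of_inner_vacuum {ε : Fin p → ℤˣ} {f : bargmannSpace m ε}
    (hf : ∀ z, inner ℂ (vacuum m ε) (bargmannRep m ε (heis z) f) = 0) : f = 0 := by
  obtain ⟨h, hh, hfh⟩ := f.2
  have h0 : h = 0 := by
    funext z
    have h1 := hf z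
    rw [inner_vacuum_bargmannRep f hh hfh] at h1
    have h2 := gaussianMass_ne_zero (p := p) (m := m)
    have h3 := (Real.exp_pos (-(1 / 2) * normSqZ z)).ne'
    simpa [h2, h3, -Complex.ofReal_exp] using h1
  subst h0
  exact Subtype.ext (Lp.ext (hfh.trans (Lp.coeFn_zero ℂ 2 (gaussian p m)).symm))

/-- The inner products with the coherent states form a function of type `ε`. -/
theorem isHolomorphicOfType_inner (ε : Fin p → ℤˣ) (f : Lp ℂ 2 (gaussian p m)) :
    IsHolomorphicOfType ε fun z => (Real.exp (1 / 2 * normSqZ z) : ℂ) *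
      inner ℂ (weylOp ε (heis (-z)) (vacuum m ε).1) f := by
  -- Once the factor `exp (|z|²/2)` cancels the normalization of the coherent state, the exponent
  -- left is bilinear in `ζ` and `ω w`: the rows with `ε_i = 1` contribute `conj w_i`, the others
  -- `w_i`. The inner product is a Laplace transform of `f`.
  set ω : Z p m → Z p m := fun w => conjRows ε fun i j => conj (w i j) with hω
  have hωc : Continuous ω := by
    refine (continuous_conjRows ε).comp ?_
    fun_prop
  have hωn : ∀ w, ‖ω w‖ ≤ ‖w‖ := fun w => by
    refine (pi_norm_le_iff_of_nonneg (norm_nonneg _)).2 fun i =>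
      (pi_norm_le_iff_of_nonneg (norm_nonneg _)).2 fun j => ?_
    have h1 : ‖ω w i j‖ = ‖w i j‖ := by
      simp only [hω, conjRows]
      split_ifs <;> simp
    rw [h1]
    exact (norm_le_pi_norm (w i) j).trans (norm_le_pi_norm w i)
  have hd := differentiable_laplace hωc hωn (Lp.memLp f)
  unfold IsHolomorphicOfType
  convert hd using 2 with ζ
  beta_reduce
  rw [L2.inner_def, ← integral_const_mul]
  refine integral_congr_ae ?_
  filter_upwards [(weylOp_coeFn ε (heis (-conjRows ε ζ)) (vacuum m ε).1).trans
    (weyl_congr ε _ (vacuum_coeFn ε))] with w hw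
  rw [hw, weyl, mul_one, RCLike.inner_apply, mul_comm (f w), ← mul_assoc, Complex.ofReal_exp,
    ← Complex.exp_conj, ← Complex.exp_add, pairing_apply]
  congr 2
  simp only [expo, normSqZ, heis, map_sum, map_sub, Complex.ofReal_mul, Complex.ofReal_sum,
    Finset.mul_sum, ← Finset.sum_add_distrib]
  refine Finset.sum_congr rfl fun i _ => ?_
  have h2 : conj (2 : ℂ) = 2 := Complex.conj_ofNat 2
  rcases Int.units_eq_one_or (ε i) with hε | hε
  · have hc : ∀ z : Z p m, ∀ j, conjRows ε z i j = z i j := fun z j => by simp [conjRows, hε]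
    simp only [hω, hc, hε, if_true]
    simp [h2, ← Complex.mul_conj', ← Finset.sum_neg_distrib]
    rw [← Finset.sum_sub_distrib, ← Finset.sum_add_distrib]
    refine Finset.sum_congr rfl fun j _ => ?_
    rw [hc]
    ring
  · have : (-1 : ℤˣ) ≠ 1 := by decide
    have hc : ∀ z : Z p m, ∀ j, conjRows ε z i j = conj (z i j) := fun z j => by
      simp [conjRows, hε, this]
    simp only [hω, hc, hε, this, if_false]
    simp [h2, ← Complex.mul_conj', ← Finset.sum_neg_distrib]
    rw [← Finset.sum_sub_distrib, ← Finset.sum_add_distrib]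
    refine Finset.sum_congr rfl fun j _ => ?_
    rw [hc, Complex.conj_conj]
    ring

/-- The reproducing formula makes sense on all of `L²`, yields functions of type `ε`, and is
continuous in `f` at each point, so it persists in the limit. Completeness is needed for the Riesz
representation that supplies adjoint vectors. -/
theorem isClosed_bargmannSpace (ε : Fin p → ℤˣ) :
    IsClosed (bargmannSpace m ε : Set (Lp ℂ 2 (gaussian p m))) := by
  refine isClosed_of_closure_subset fun f hf => ?_
  obtain ⟨u, hu, hlim⟩ := mem_closure_iff_seq_limit.1 hf
  set F : Lp ℂ 2 (gaussian p m) → Z p m → ℂ := fun f z => (gaussianMass p m : ℂ)⁻¹ *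
    ((Real.exp (1 / 2 * normSqZ z) : ℂ) * inner ℂ (weylOp ε (heis (-z)) (vacuum m ε).1) f) with hF
  have hFt : ∀ f, IsHolomorphicOfType ε (F f) := fun f =>
    Differentiable.const_mul (isHolomorphicOfType_inner ε f) _
  have hFeq : ∀ f ∈ bargmannSpace m ε, f =ᵐ[gaussian p m] F f := by
    rintro f ⟨h, hh, hfh⟩
    refine hfh.trans (Filter.Eventually.of_forall fun z => ?_)
    have h1 := inner_vacuum_bargmannRep ⟨f, h, hh, hfh⟩ hh hfh z
    rw [inner_bargmannRep_right, heis_inv] at h1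
    have h2 : inner ℂ (weylOp ε (heis (-z)) (vacuum m ε).1) f =
      gaussianMass p m * (Real.exp (-(1 / 2) * normSqZ z) * h z) := h1
    have h3 : (gaussianMass p m : ℂ) ≠ 0 := Complex.ofReal_ne_zero.2 gaussianMass_ne_zero
    have h4 : (Real.exp (1 / 2 * normSqZ z) : ℂ) * Real.exp (-(1 / 2) * normSqZ z) = 1 := by
      rw [← Complex.ofReal_mul, ← Real.exp_add]
      simp
    simp only [hF, h2]
    calc h z = (gaussianMass p m : ℂ)⁻¹ * gaussianMass p m *
          ((Real.exp (1 / 2 * normSqZ z) : ℂ) * Real.exp (-(1 / 2) * normSqZ z)) * h z := by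
          rw [h4, inv_mul_cancel₀ h3]
          ring
      _ = _ := by ring
  have hpt : ∀ z, Filter.Tendsto (fun k => F (u k) z) Filter.atTop (𝓝 (F f z)) := fun z => by
    have hc : Continuous fun f => F f z := by
      simp only [hF]
      fun_prop
    exact (hc.tendsto f).comp hlim
  obtain ⟨ns, hns, hae⟩ := (tendstoInMeasure_of_tendsto_Lp hlim).exists_seq_tendsto_ae
  refine ⟨F f, hFt f, ?_⟩
  filter_upwards [hae, ae_all_iff.2 fun k => hFeq (u k) (hu k)] with z h1 h2
  simp only [h2] at h1
  exact tendsto_nhds_unique h1 ((hpt z).comp hns.tendsto_atTop)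

instance completeSpace_bargmannSpace (ε : Fin p → ℤˣ) : CompleteSpace (bargmannSpace m ε) :=
  (isClosed_bargmannSpace ε).completeSpace_coe

/-- An entire function whose complex conjugate is entire is constant. -/
theorem eq_of_differentiable_of_differentiable_conj {E : Type*} [NormedAddCommGroup E]
    [NormedSpace ℂ E] {F : E → ℂ} (h1 : Differentiable ℂ F)
    (h2 : Differentiable ℂ fun z => conj (F z)) (x y : E) : F x = F y := by
  refine is_const_of_fderiv_eq_zero (𝕜 := ℂ) h1 (fun z => ?_) x y
  ext v
  have d1 := (h1 z).hasFDerivAt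
  have d2 := (h2 z).hasFDerivAt
  have e1 : HasFDerivAt (fun z => conj (F z))
      ((Complex.conjCLE : ℂ →L[ℝ] ℂ).comp ((fderiv ℂ F z).restrictScalars ℝ)) z :=
    (Complex.conjCLE : ℂ →L[ℝ] ℂ).hasFDerivAt.comp z (d1.restrictScalars ℝ)
  have e2 := e1.unique (d2.restrictScalars ℝ)
  have h3 := DFunLike.congr_fun e2 v
  -- The differential of `conj F` is complex linear by hypothesis and conjugate linear as the
  -- conjugate of `dF`; comparing its values at `v` and `i v` makes it vanish.
  have h4 := DFunLike.congr_fun e2 (Complex.I • v)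
  simp only [ContinuousLinearMap.comp_apply, ContinuousLinearMap.coe_restrictScalars', map_smul,
    ContinuousLinearEquiv.coe_coe, Complex.conjCLE_apply, smul_eq_mul, map_mul, Complex.conj_I]
    at h3 h4
  rw [← h3] at h4
  have h5 : conj (fderiv ℂ F z v) = 0 := by
    have h6 : (2 * Complex.I) * conj (fderiv ℂ F z v) = 0 := by linear_combination -h4
    simpa using h6
  simpa using h5

/-- A vector whose matrix coefficients with the vacuum are matrix coefficients of the vacuum is a
multiple of the vacuum. -/
theorem eq_smul_vacuum {ε : Fin p → ℤˣ} {a b : bargmannSpace m ε}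
    (hab : ∀ z, inner ℂ b (bargmannRep m ε (heis z) (vacuum m ε)) =
      inner ℂ (vacuum m ε) (bargmannRep m ε (heis z) a)) :
    ∃ c : ℂ, a = c • vacuum m ε ∧ b = conj c • vacuum m ε := by
  obtain ⟨h, hh, hah⟩ := a.2
  obtain ⟨k, hk, hbk⟩ := b.2
  have hm : (gaussianMass p m : ℂ) ≠ 0 := Complex.ofReal_ne_zero.2 gaussianMass_ne_zero
  -- Moving `T(0,z)` to the other side turns the left coefficient into the conjugate of the value of
  -- `k` at `-z`, with the same Gaussian factor as on the right. Hence both `h` and its conjugate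
  -- are of type `ε`, which forces `h` to be constant.
  have key : ∀ z, conj (k (-z)) = h z := fun z => by
    have h1 := hab z
    rw [inner_bargmannRep_right, heis_inv,
      ← inner_conj_symm (bargmannRep m ε (heis (-z)) b) (vacuum m ε),
      inner_vacuum_bargmannRep b hk hbk, inner_vacuum_bargmannRep a hh hah] at h1
    have h2 : normSqZ (-z) = normSqZ z := by simp [normSqZ]
    rw [h2, map_mul, map_mul, Complex.conj_ofReal, Complex.conj_ofReal] at h1
    have h3 : (Real.exp (-(1 / 2) * normSqZ z) : ℂ) ≠ 0 :=
      Complex.ofReal_ne_zero.2 (Real.exp_pos _).ne'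
    exact mul_left_cancel₀ h3 (mul_left_cancel₀ hm h1)
  have hneg : ∀ z : Z p m, conjRows ε (-z) = -conjRows ε z := fun z => by
    funext i j
    simp only [conjRows, Pi.neg_apply]
    split_ifs <;> simp
  have hconst : ∀ x y : Z p m, h (conjRows ε x) = h (conjRows ε y) := by
    refine eq_of_differentiable_of_differentiable_conj hh ?_
    have h1 : ∀ z, conj (h (conjRows ε z)) = k (conjRows ε (-z)) := fun z => by
      rw [← key, Complex.conj_conj, hneg]
    simp only [h1]
    exact Differentiable.comp (g := fun z => k (conjRows ε z)) hk
      (differentiable_id (𝕜 := ℂ) (E := Z p m)).neg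
  have hc : ∀ z, h z = h 0 := fun z => by
    have h1 := hconst (conjRows ε z) (conjRows ε 0)
    rwa [conjRows_conjRows, conjRows_conjRows] at h1
  have aux : ∀ (f : bargmannSpace m ε) (c : ℂ), f.1 =ᵐ[gaussian p m] (fun _ => c) →
      f = c • vacuum m ε := fun f c hf => by
    refine Subtype.ext (Lp.ext (hf.trans ?_))
    refine ((Lp.coeFn_smul c (vacuum m ε).1).trans ?_).symm
    filter_upwards [vacuum_coeFn (m := m) ε] with w hw
    simp [hw]
  refine ⟨h 0, aux a _ (hah.trans (Filter.Eventually.of_forall hc)), aux b _ (hbk.trans ?_)⟩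
  refine Filter.Eventually.of_forall fun z => ?_
  have h1 := key (-z)
  rw [neg_neg, hc] at h1
  simp only [← h1, Complex.conj_conj]

theorem inner_vacuum_self (ε : Fin p → ℤˣ) :
    inner ℂ (vacuum m ε) (vacuum m ε) = (gaussianMass p m : ℂ) := by
  rw [inner_vacuum (vacuum m ε) (h := fun _ => 1) (differentiable_const (1 : ℂ)) (vacuum_coeFn ε),
    mul_one]

theorem vacuum_ne_zero (ε : Fin p → ℤˣ) : vacuum m ε ≠ 0 := by
  intro h
  have h1 := inner_vacuum_self (m := m) ε
  rw [h, inner_zero_left] at h1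
  exact gaussianMass_ne_zero (Complex.ofReal_eq_zero.1 h1.symm)

end fiber


/-! ### Fourier uniqueness for images of complex densities -/

section fourier

variable {p m : ℕ} {X Y : Type*} [MeasurableSpace X] [MeasurableSpace Y]

/-- The character `v ↦ exp(i Re ∑ b_ij v_ij)`. -/
def character (b v : Z p m) : ℂ := Complex.exp (((pairing b v).re : ℂ) * Complex.I)

theorem norm_character (b v : Z p m) : ‖character b v‖ = 1 := Complex.norm_exp_ofReal_mul_I _

theorem continuous_character (b : Z p m) : Continuous (character b) := by
  unfold character
  fun_prop

theorem conj_character (b v : Z p m) : conj (character b v) = character (-b) v := by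
  have : pairing (-b) v = -pairing b v := by simp [pairing_apply]
  rw [character, character, this, ← Complex.exp_conj]
  simp

theorem measure_eq_of_integral_character_eq {P Q : Measure (Z p m)} [IsFiniteMeasure P]
    [IsFiniteMeasure Q] (h : ∀ b, ∫ v, character b v ∂P = ∫ v, character b v ∂Q) : P = Q := by
  let L : Z p m →ₗ[ℝ] Z p m →ₗ[ℝ] ℝ := LinearMap.mk₂ ℝ (fun v b => (pairing b v).re)
    (fun v v' b => by simp) (fun c v b => by simp)
    (fun v b b' => by simp [pairing_apply, add_mul, Finset.sum_add_distrib])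
    (fun c v b => by
      have : pairing (c • b) v = (c : ℂ) * pairing b v := by
        simp [pairing_apply, mul_assoc, Finset.mul_sum]
      simp [this])
  have hL : Continuous fun q : Z p m × Z p m => L q.1 q.2 := by
    change Continuous fun q : Z p m × Z p m => (pairing q.2 q.1).re
    simp only [pairing_apply]
    fun_prop
  refine ext_of_integral_char_eq Real.continuous_probChar
    Real.probChar_ne_one (L := L) (fun v hv hLv => hv ?_) hL h
  -- Nondegeneracy of the real pairing: testing `v` against its own conjugate gives `tr v v*`.
  have h1 : (pairing (fun i j => conj (v i j)) v).re = 0 := LinearMap.congr_fun hLv _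
  have h2 : normSqZ v = 0 := by
    rw [← h1, pairing_apply, normSqZ]
    simp [Complex.conj_mul', ← Complex.ofReal_pow]
  have h3 := sq_norm_le_normSqZ v
  rw [h2] at h3
  exact norm_eq_zero.1 (pow_eq_zero_iff two_ne_zero |>.1 (le_antisymm h3 (sq_nonneg _)))

/-- The image under `Φ` of the positive part of the measure `g μ`. -/
def positiveImage (μ : Measure X) (g : X → ℝ) (Φ : X → Z p m) : Measure (Z p m) :=
  (μ.withDensity fun x => ENNReal.ofReal (g x)).map Φ

theorem isFiniteMeasure_positiveImage {μ : Measure X} {g : X → ℝ} (hg : Integrable g μ)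
    (Φ : X → Z p m) : IsFiniteMeasure (positiveImage μ g Φ) := by
  have := isFiniteMeasure_withDensity_ofReal hg.2
  unfold positiveImage
  infer_instance

theorem integrable_character_mul {μ : Measure X} {f : X → ℂ} (hf : Integrable f μ)
    {Φ : X → Z p m} (hΦ : Measurable Φ) (b : Z p m) :
    Integrable (fun x => character b (Φ x) * f x) μ :=
  hf.bdd_mul ((continuous_character b).measurable.comp hΦ).aestronglyMeasurable
    (Filter.Eventually.of_forall fun x => (norm_character b (Φ x)).le)

theorem integral_character_positiveImage {μ : Measure X} {g : X → ℝ} (hg : Integrable g μ)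
    {Φ : X → Z p m} (hΦ : Measurable Φ) (b : Z p m) :
    ∫ v, character b v ∂(positiveImage μ g Φ) = ∫ x, character b (Φ x) * (max (g x) 0 : ℝ) ∂μ := by
  rw [positiveImage, integral_map hΦ.aemeasurable (continuous_character b).aestronglyMeasurable,
    integral_withDensity_eq_integral_toReal_smul₀ hg.1.aemeasurable.ennreal_ofReal
      (Filter.Eventually.of_forall fun _ => ENNReal.ofReal_lt_top)]
  refine integral_congr_ae (Filter.Eventually.of_forall fun x => ?_)
  simp only [ENNReal.toReal_ofReal', Complex.real_smul]
  rw [mul_comm]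

theorem integral_character_sub {μ : Measure X} {g : X → ℝ} (hg : Integrable g μ)
    {Φ : X → Z p m} (hΦ : Measurable Φ) (b : Z p m) :
    ∫ v, character b v ∂(positiveImage μ g Φ) - ∫ v, character b v ∂(positiveImage μ (-g) Φ) =
      ∫ x, character b (Φ x) * (g x : ℂ) ∂μ := by
  rw [integral_character_positiveImage hg hΦ, integral_character_positiveImage hg.neg hΦ,
    ← integral_sub (f := fun x => character b (Φ x) * (max (g x) 0 : ℝ))
      (g := fun x => character b (Φ x) * (max ((-g) x) 0 : ℝ))
      (integrable_character_mul hg.pos_part.ofReal hΦ b)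
      (integrable_character_mul hg.neg.pos_part.ofReal hΦ b)]
  refine integral_congr_ae (Filter.Eventually.of_forall fun x => ?_)
  simp only [Pi.neg_apply, ← mul_sub, ← Complex.ofReal_sub]
  rw [max_zero_sub_eq_self]

theorem setIntegral_eq_positiveImage {μ : Measure X} {g : X → ℝ} (hg : Integrable g μ)
    {Φ : X → Z p m} (hΦ : Measurable Φ) {E : Set (Z p m)} (hE : MeasurableSet E) :
    ∫ x in Φ ⁻¹' E, g x ∂μ = (positiveImage μ g Φ).real E - (positiveImage μ (-g) Φ).real E := by
  rw [integral_eq_lintegral_pos_part_sub_lintegral_neg_part hg.integrableOn, positiveImage,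
    positiveImage, measureReal_def, measureReal_def, Measure.map_apply hΦ hE,
    Measure.map_apply hΦ hE, withDensity_apply _ (hΦ hE), withDensity_apply _ (hΦ hE)]
  rfl

theorem setIntegral_preimage_eq_real {μ : Measure X} {ν : Measure Y} {g : X → ℝ} {k : Y → ℝ}
    (hg : Integrable g μ) (hk : Integrable k ν) {Φ : X → Z p m} {Ψ : Y → Z p m}
    (hΦ : Measurable Φ) (hΨ : Measurable Ψ)
    (h : ∀ b, ∫ x, character b (Φ x) * (g x : ℂ) ∂μ = ∫ y, character b (Ψ y) * (k y : ℂ) ∂ν)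
    {E : Set (Z p m)} (hE : MeasurableSet E) :
    ∫ x in Φ ⁻¹' E, g x ∂μ = ∫ y in Ψ ⁻¹' E, k y ∂ν := by
  have i1 := isFiniteMeasure_positiveImage hg Φ
  have i2 := isFiniteMeasure_positiveImage hg.neg Φ
  have i3 := isFiniteMeasure_positiveImage hk Ψ
  have i4 := isFiniteMeasure_positiveImage hk.neg Ψ
  have hint : ∀ (P : Measure (Z p m)) [IsFiniteMeasure P] (b : Z p m),
      Integrable (character b) P := fun P _ b =>
    Integrable.of_bound (continuous_character b).aestronglyMeasurable 1
      (Filter.Eventually.of_forall fun v => (norm_character b v).le)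
  -- Uniqueness is available for positive finite measures only, so the negative parts are moved
  -- across the equality before it is applied.
  have key : positiveImage μ g Φ + positiveImage ν (-k) Ψ =
      positiveImage μ (-g) Φ + positiveImage ν k Ψ := by
    refine measure_eq_of_integral_character_eq fun b => ?_
    rw [integral_add_measure (hint _ b) (hint _ b), integral_add_measure (hint _ b) (hint _ b)]
    have h1 := h b
    rw [← integral_character_sub hg hΦ, ← integral_character_sub hk hΨ] at h1
    linear_combination h1
  have h2 := congrArg (fun P => P.real E) key
  have h3 : (positiveImage μ g Φ).real E + (positiveImage ν (-k) Ψ).real E =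
      (positiveImage μ (-g) Φ).real E + (positiveImage ν k Ψ).real E := by
    rw [← measureReal_add_apply, ← measureReal_add_apply]
    exact h2
  rw [setIntegral_eq_positiveImage hg hΦ hE, setIntegral_eq_positiveImage hk hΨ hE]
  linarith

/-- Equality of transforms at every `b` thereby passes to conjugate densities, and so to real and
imaginary parts. -/
theorem integral_character_conj {μ : Measure X} {g : X → ℂ} {Φ : X → Z p m} (b : Z p m) :
    ∫ x, character b (Φ x) * conj (g x) ∂μ = conj (∫ x, character (-b) (Φ x) * g x ∂μ) := by
  rw [← integral_conj]
  simp only [map_mul, conj_character, neg_neg]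

theorem integrable_conj {μ : Measure X} {g : X → ℂ} (hg : Integrable g μ) :
    Integrable (fun x => conj (g x)) μ :=
  (Complex.conjCLE : ℂ →L[ℝ] ℂ).integrable_comp hg

theorem integral_character_re {μ : Measure X} {g : X → ℂ} (hg : Integrable g μ) {Φ : X → Z p m}
    (hΦ : Measurable Φ) (b : Z p m) :
    ∫ x, character b (Φ x) * ((g x).re : ℂ) ∂μ =
      (1 / 2) * (∫ x, character b (Φ x) * g x ∂μ + ∫ x, character b (Φ x) * conj (g x) ∂μ) := by
  rw [← integral_add (integrable_character_mul hg hΦ b)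
    (integrable_character_mul (integrable_conj hg) hΦ b), ← integral_const_mul]
  refine integral_congr_ae (Filter.Eventually.of_forall fun x => ?_)
  simp only [Complex.re_eq_add_conj]
  ring

theorem integral_character_im {μ : Measure X} {g : X → ℂ} (hg : Integrable g μ) {Φ : X → Z p m}
    (hΦ : Measurable Φ) (b : Z p m) :
    ∫ x, character b (Φ x) * ((g x).im : ℂ) ∂μ = (1 / (2 * Complex.I)) *
      (∫ x, character b (Φ x) * g x ∂μ - ∫ x, character b (Φ x) * conj (g x) ∂μ) := by
  rw [← integral_sub (integrable_character_mul hg hΦ b)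
    (integrable_character_mul (integrable_conj hg) hΦ b), ← integral_const_mul]
  refine integral_congr_ae (Filter.Eventually.of_forall fun x => ?_)
  simp only [Complex.im_eq_sub_conj]
  ring

/-- Integrable densities with the same Fourier transform have the same images. -/
theorem setIntegral_preimage_eq {μ : Measure X} {ν : Measure Y} {g : X → ℂ} {k : Y → ℂ}
    (hg : Integrable g μ) (hk : Integrable k ν) {Φ : X → Z p m} {Ψ : Y → Z p m}
    (hΦ : Measurable Φ) (hΨ : Measurable Ψ)
    (h : ∀ b, ∫ x, character b (Φ x) * g x ∂μ = ∫ y, character b (Ψ y) * k y ∂ν)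
    {E : Set (Z p m)} (hE : MeasurableSet E) :
    ∫ x in Φ ⁻¹' E, g x ∂μ = ∫ y in Ψ ⁻¹' E, k y ∂ν := by
  have hc : ∀ b, ∫ x, character b (Φ x) * conj (g x) ∂μ =
      ∫ y, character b (Ψ y) * conj (k y) ∂ν := fun b => by
    rw [integral_character_conj, integral_character_conj, h]
  have e1 := setIntegral_preimage_eq_real hg.re hk.re hΦ hΨ (fun b =>
    (integral_character_re hg hΦ b).trans
      (by rw [h, hc]; exact (integral_character_re hk hΨ b).symm)) hE
  have e2 := setIntegral_preimage_eq_real hg.im hk.im hΦ hΨ (fun b =>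
    (integral_character_im hg hΦ b).trans
      (by rw [h, hc]; exact (integral_character_im hk hΨ b).symm)) hE
  rw [← integral_re_add_im hg.integrableOn, ← integral_re_add_im hk.integrableOn, e1, e2]

end fourier

/-! ### The Hermitian matrices `s* E s` and the action of the centre -/

section hermitianForms

variable {p m : ℕ}

/-- The Hermitian matrix `s* E s`, `E = diag(ε)`. -/
def formMat (ε : Fin p → ℤˣ) (s : S p) : Matrix (Fin p) (Fin p) ℂ :=
  (mat s)ᴴ * Matrix.diagonal (fun i => ((ε i : ℤ) : ℂ)) * mat s

theorem formMat_mul (ε : Fin p → ℤˣ) (s t : S p) :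
    formMat ε (s * t) = (mat t)ᴴ * formMat ε s * mat t := by
  simp [formMat, mat_mul, Matrix.mul_assoc]

theorem mat_mul_inv (s : S p) : mat s * mat s⁻¹ = 1 := by
  rw [← mat_mul, mul_inv_cancel, mat_one]

theorem conjTranspose_formMat (ε : Fin p → ℤˣ) (s : S p) : (formMat ε s)ᴴ = formMat ε s := by
  have : (Matrix.diagonal (fun i => ((ε i : ℤ) : ℂ)))ᴴ =
      Matrix.diagonal (fun i => ((ε i : ℤ) : ℂ)) := by
    rw [Matrix.diagonal_conjTranspose]
    congr 1
    funext i
    simp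
  simp [formMat, this, Matrix.mul_assoc]

/-- Rewriting the hypothesis as `E u = (u⁻¹)* E'` equates a lower triangular matrix with an upper
triangular one, so `u` is diagonal. A diagonal entry `r > 0` satisfies `ε_i r = ε'_i r⁻¹`;
positivity matches the signs, and then `r² = 1` gives `r = 1`. -/
theorem eq_one_of_formMat_eq {ε ε' : Fin p → ℤˣ} {u : S p}
    (h : formMat ε u = Matrix.diagonal (fun i => ((ε' i : ℤ) : ℂ))) : ε = ε' ∧ u = 1 := by
  have h1 : Matrix.diagonal (fun i => ((ε i : ℤ) : ℂ)) * mat u =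
      (mat u⁻¹)ᴴ * Matrix.diagonal (fun i => ((ε' i : ℤ) : ℂ)) := by
    rw [← h, formMat, ← Matrix.mul_assoc, ← Matrix.mul_assoc, ← Matrix.conjTranspose_mul,
      mat_mul_inv, Matrix.conjTranspose_one, Matrix.one_mul]
  have h2 : ∀ i j, ((ε i : ℤ) : ℂ) * mat u i j = conj (mat u⁻¹ j i) * ((ε' j : ℤ) : ℂ) := by
    intro i j
    have := congrFun (congrFun h1 i) j
    rwa [Matrix.diagonal_mul, Matrix.mul_diagonal, Matrix.conjTranspose_apply] at this
  have hε : ∀ i, ((ε i : ℤ) : ℂ) ≠ 0 := fun i => by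
    rcases Int.units_eq_one_or (ε i) with h | h <;> simp [h]
  have hoff : ∀ i j, i ≠ j → mat u i j = 0 := by
    intro i j hij
    rcases lt_or_gt_of_ne hij with hlt | hgt
    · exact u.2.1 i j hlt
    · have h3 := h2 i j
      have h4 : mat u⁻¹ j i = 0 := (u⁻¹).2.1 j i hgt
      rw [h4, map_zero, zero_mul] at h3
      exact (mul_eq_zero.1 h3).resolve_left (hε i)
  have hdiag : ∀ i, ε i = ε' i ∧ mat u i i = 1 := by
    intro i
    obtain ⟨r, hr, hr'⟩ := u.2.2 i
    obtain ⟨t, ht, ht'⟩ := (u⁻¹).2.2 i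
    have hr2 : mat u i i = r := hr'
    have ht2 : mat u⁻¹ i i = t := ht'
    have h3 := h2 i i
    have h4 := congrFun (congrFun (mat_mul_inv u) i) i
    rw [Matrix.mul_apply, Finset.sum_eq_single i (fun k _ hk => by
      rw [hoff i k hk.symm, zero_mul]) (by simp), Matrix.one_apply_eq, hr2, ht2] at h4
    rw [hr2, ht2, Complex.conj_ofReal] at h3
    have h5 : r * t = 1 := by exact_mod_cast h4
    have h6 : ((ε i : ℤ) : ℝ) * r = t * ((ε' i : ℤ) : ℝ) := by exact_mod_cast h3
    have h7 : ε i = ε' i := by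
      rcases Int.units_eq_one_or (ε i) with h | h <;>
        rcases Int.units_eq_one_or (ε' i) with h' | h' <;> simp [h, h'] at h6 ⊢ <;> linarith
    refine ⟨h7, ?_⟩
    have h8 : r = t := by
      rw [h7] at h6
      rcases Int.units_eq_one_or (ε' i) with h' | h' <;> simp [h'] at h6 <;> linarith
    subst h8
    rw [hr2, show r = 1 by nlinarith, Complex.ofReal_one]
  refine ⟨funext fun i => (hdiag i).1, Subtype.ext (Units.ext ?_)⟩
  ext i j
  change mat u i j = (1 : Matrix (Fin p) (Fin p) ℂ) i j
  by_cases hij : i = j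
  · subst hij
    rw [(hdiag i).2, Matrix.one_apply_eq]
  · rw [hoff i j hij, Matrix.one_apply_ne hij]

/-- The Hermitian matrix `s* E s` determines the signs and the element of `S`. -/
theorem formMat_injective {ε ε' : Fin p → ℤˣ} {s t : S p} (h : formMat ε s = formMat ε' t) :
    ε = ε' ∧ s = t := by
  -- Congruence by `t⁻¹` reduces the claim to the case where the second element of `S` is 1.
  have h1 : formMat ε (s * t⁻¹) = Matrix.diagonal (fun i => ((ε' i : ℤ) : ℂ)) := by
    rw [formMat_mul, h, ← formMat_mul, mul_inv_cancel, formMat, mat_one]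
    simp
  obtain ⟨h2, h3⟩ := eq_one_of_formMat_eq h1
  exact ⟨h2, mul_inv_eq_one.1 h3⟩

/-- The map `s ↦ s* E s` into the space of matrices. -/
def form (ε : Fin p → ℤˣ) (s : S p) : Z p p := Matrix.of.symm (formMat ε s)

theorem continuous_form (ε : Fin p → ℤˣ) : Continuous (form ε) :=
  (continuous_mat.matrix_conjTranspose.matrix_mul continuous_const).matrix_mul continuous_mat

/-- `GL` is Polish, as a closed subspace of pairs of matrices via `g ↦ (g, g⁻¹)`, and `S` is a Borel
subset of it. This lets the Lusin–Souslin theorem turn the continuous injection `form ε` into a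
Borel embedding. -/
instance standardBorelSpace_S : StandardBorelSpace (S p) := by
  have h1 : PolishSpace (Matrix (Fin p) (Fin p) ℂ) :=
    inferInstanceAs (PolishSpace (Fin p → Fin p → ℂ))
  have h2 : PolishSpace (Matrix (Fin p) (Fin p) ℂ)ᵐᵒᵖ :=
    (MulOpposite.opHomeomorph (M := Matrix (Fin p) (Fin p) ℂ)).symm.isClosedEmbedding.polishSpace
  have h3 : PolishSpace (GL (Fin p) ℂ) :=
    Units.isClosedEmbedding_embedProduct.polishSpace
  let _ : MeasurableSpace (GL (Fin p) ℂ) := borel _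
  have : BorelSpace (GL (Fin p) ℂ) := ⟨rfl⟩
  have hentry : ∀ i j, Measurable fun s : GL (Fin p) ℂ => (s : Matrix (Fin p) (Fin p) ℂ) i j :=
    fun i j => (Units.continuous_val.matrix_elem i j).measurable
  have hpos : MeasurableSet {x : ℂ | ∃ r : ℝ, 0 < r ∧ x = r} := by
    have : {x : ℂ | ∃ r : ℝ, 0 < r ∧ x = r} = {x | 0 < x.re} ∩ {x | x.im = 0} := by
      ext x
      constructor
      · rintro ⟨r, hr, rfl⟩
        simpa using hr
      · rintro ⟨h, h'⟩
        exact ⟨x.re, h, Complex.ext rfl (by simpa using h')⟩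
    rw [this]
    exact (measurableSet_lt measurable_const Complex.measurable_re).inter
      (Complex.measurable_im (measurableSet_singleton 0))
  have hS : MeasurableSet (S p : Set (GL (Fin p) ℂ)) := by
    refine MeasurableSet.inter (s₁ := {s : GL (Fin p) ℂ | ∀ i j, i < j →
      (s : Matrix (Fin p) (Fin p) ℂ) i j = 0}) (s₂ := {s : GL (Fin p) ℂ | ∀ i, ∃ r : ℝ, 0 < r ∧
        (s : Matrix (Fin p) (Fin p) ℂ) i i = r}) ?_ ?_
    · simp only [Set.ofPred_forall]
      exact MeasurableSet.iInter fun i => MeasurableSet.iInter fun j => MeasurableSet.iInter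
        fun _ => hentry i j (measurableSet_singleton 0)
    · simp only [Set.ofPred_forall]
      exact MeasurableSet.iInter fun i => hentry i i hpos
  have h4 := hS.standardBorel
  have h6 : (Subtype.instMeasurableSpace : MeasurableSpace (S p)) = borel (S p) :=
    BorelSpace.measurable_eq
  rw [h6] at h4
  exact h4

theorem measurableEmbedding_form (ε : Fin p → ℤˣ) : MeasurableEmbedding (form ε) :=
  (continuous_form ε).measurable.measurableEmbedding fun _ _ h => (formMat_injective h).2

theorem disjoint_range_form {ε ε' : Fin p → ℤˣ} (h : ε ≠ ε') (s t : S p) : form ε s ≠ form ε' t :=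
  fun hst => h (formMat_injective hst).1

/-- The central element of `N` whose operators are the multiplications by `character b`. -/
def central (m : ℕ) (b : Z p p) : N p m where
  -- The factor `i` times the Hermitian part of `bᵀ` is skew-Hermitian, and since `s* E s` is
  -- Hermitian, its trace against this matrix is `i Re tr (s* E s bᵀ)`, the exponent of the
  -- character.
  n := (Complex.I / 2) • ((Matrix.of b)ᵀ + ((Matrix.of b)ᵀ)ᴴ)
  z := 0
  skew := by
    rw [Matrix.conjTranspose_smul, Matrix.conjTranspose_add, Matrix.conjTranspose_conjTranspose,
      add_comm, ← neg_smul]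
    congr 1
    simp [neg_div]

theorem expo_conjN_central (ε : Fin p → ℤˣ) (s : S p) (b : Z p p) (w : Z p m) :
    expo ε (conjN s (central m b)) w = ((pairing b (form ε s)).re : ℂ) * Complex.I := by
  have hz : (conjN s (central m b)).z = 0 := by
    have := act_add s (0 : Z p m) 0
    rw [add_zero] at this
    exact left_eq_add.1 this
  have hn : ∀ n : Matrix (Fin p) (Fin p) ℂ,
      ∑ i, ((ε i : ℤ) : ℂ) * (mat s * n * (mat s)ᴴ) i i = (formMat ε s * n).trace := by
    intro n
    have h1 : ∑ i, ((ε i : ℤ) : ℂ) * (mat s * n * (mat s)ᴴ) i i =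
        (Matrix.diagonal (fun i => ((ε i : ℤ) : ℂ)) * (mat s * n * (mat s)ᴴ)).trace := by
      simp [Matrix.trace, Matrix.diagonal_mul]
    rw [h1, ← Matrix.mul_assoc, Matrix.trace_mul_comm, formMat]
    simp only [Matrix.mul_assoc]
  have hp : pairing b (form ε s) = (formMat ε s * (Matrix.of b)ᵀ).trace := by
    rw [pairing_apply]
    simp [Matrix.trace, Matrix.mul_apply, form, mul_comm]
  have hp' : conj (pairing b (form ε s)) = (formMat ε s * ((Matrix.of b)ᵀ)ᴴ).trace := by
    rw [hp, Matrix.trace_mul_comm, ← Complex.star_def, ← Matrix.trace_conjTranspose,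
      Matrix.conjTranspose_mul,
      conjTranspose_formMat]
  simp only [expo, hz]
  simp only [Pi.zero_apply, zero_mul, map_zero, mul_zero, Finset.sum_const_zero, ite_self, sub_zero]
  rw [show (conjN s (central m b)).n = mat s * (central m b).n * (mat s)ᴴ from rfl, hn]
  simp only [central, Matrix.mul_smul, Matrix.mul_add, Matrix.trace_smul, Matrix.trace_add, ← hp,
    ← hp', Complex.re_eq_add_conj, smul_eq_mul]
  ring

theorem bargmannRepAt_central (ε : Fin p → ℤˣ) (s : S p) (b : Z p p) (f : bargmannSpace m ε) :
    bargmannRepAt m ε s (central m b) f = character b (form ε s) • f := by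
  refine Subtype.ext (Lp.ext ?_)
  refine (bargmannRep_coeFn ε (conjN s (central m b)) f Filter.EventuallyEq.rfl).trans ?_
  refine Filter.EventuallyEq.trans ?_ (Lp.coeFn_smul (character b (form ε s)) f.1).symm
  have hz : (conjN s (central m b)).z = 0 := by
    have := act_add s (0 : Z p m) 0
    rw [add_zero] at this
    exact left_eq_add.1 this
  refine Filter.Eventually.of_forall fun w => ?_
  simp only [weyl, expo_conjN_central, hz, add_zero, Pi.smul_apply, smul_eq_mul]
  rfl

end hermitianForms


/-! ### Translation-invariant functions on `S` -/

section ergodicity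

variable {p : ℕ}

/-- A function on `S` that is invariant, up to null sets, under all right translations is constant
almost everywhere with respect to an almost invariant measure. -/
theorem exists_ae_eq_const {ν : Measure (S p)} [SigmaFinite ν] (hν : IsAlmostInvariant ν)
    {c : S p → ℂ} (hc : Measurable c) (h : ∀ s₀, ∀ᵐ s ∂ν, c (s * s₀) = c s) :
    ∃ b, ∀ᵐ s ∂ν, c s = b := by
  have hms : MeasurableSet {q : S p × S p | c (q.1 * q.2⁻¹) = c q.1} :=
    measurableSet_eq_fun (hc.comp (measurable_fst.mul measurable_snd.inv)) (hc.comp measurable_fst)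
  -- Fubini exchanges the null sets. The substitution `r ↦ r s` below, allowed by quasi-invariance,
  -- then removes `s` from the left side; with `r⁻¹` in the argument, right translations alone
  -- suffice. As `c r⁻¹` does not involve `s`, any two good values of `c` can be compared at a
  -- common `r`.
  have h1 : ∀ᵐ s ∂ν, ∀ᵐ r ∂ν, c (s * r⁻¹) = c s :=
    (Measure.ae_ae_comm hms).2 (Filter.Eventually.of_forall fun r => h r⁻¹)
  have h2 : ∀ᵐ s ∂ν, ∀ᵐ r ∂ν, c r⁻¹ = c s := by
    filter_upwards [h1] with s hs
    filter_upwards [(quasi_mul hν s).ae hs] with r hr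
    rwa [_root_.mul_inv_rev, mul_inv_cancel_left] at hr
  rcases eq_or_ne ν 0 with rfl | h0
  · exact ⟨0, by simp⟩
  have := ae_neBot.2 h0
  obtain ⟨s₁, hs₁⟩ := h2.exists
  refine ⟨c s₁, ?_⟩
  filter_upwards [h2] with s hs
  obtain ⟨r, hr, hr'⟩ := (hs.and hs₁).exists
  rw [← hr, hr']

end ergodicity

/-! ### Adjoint vectors in `L²` spaces of sections -/

section adjoint

variable {X Y K K' : Type*} [MeasurableSpace X] [MeasurableSpace Y] {μ : Measure X}
  {ρ : Measure Y} [NormedAddCommGroup K] [NormedAddCommGroup K'] [InnerProductSpace ℂ K]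
  [InnerProductSpace ℂ K']

theorem exists_adjoint_Lp [CompleteSpace K] (A : Lp K 2 μ →L[ℂ] Lp K' 2 ρ) (h : Lp K' 2 ρ) :
    ∃ k : Lp K 2 μ, ∀ f : Lp K 2 μ,
      ∫ x, inner ℂ (k x) (f x) ∂μ = ∫ y, inner ℂ (h y) (A f y) ∂ρ := by
  refine ⟨(InnerProductSpace.toDual ℂ (Lp K 2 μ)).symm ((innerSL ℂ h).comp A), fun f => ?_⟩
  rw [← L2.inner_def, ← L2.inner_def]
  simp

theorem Lp_eq_zero_of_integral_inner {F : Lp K 2 μ} (h : ∫ x, inner ℂ (F x) (F x) ∂μ = 0) :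
    F = 0 :=
  inner_self_eq_zero.1 ((L2.inner_def (𝕜 := ℂ) F F).trans h)

theorem aemeasurable_inner_const (v : K) (F : Lp K 2 μ) :
    AEMeasurable (fun x => inner ℂ v (F x)) μ :=
  (aestronglyMeasurable_const.inner (Lp.aestronglyMeasurable F)).aemeasurable

end adjoint

/-! ### Intertwining operators and the two assertions of the theorem -/

section intertwining

variable {p m : ℕ} {ε ε' : Fin p → ℤˣ} {ν ν' : Measure (S p)}

theorem iwasawaRep_inl [SigmaFinite ν] (hν : IsAlmostInvariant ν) (g : N p m) :
    iwasawaRep m ε ν hν (SemidirectProduct.inl g) = nOp ε ν g := by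
  have h1 : sOp m ε ν hν 1 = 1 := by
    ext1 f
    refine Lp.ext ((sOp_coeFn ε ν hν 1 f).trans ?_)
    simp only [mul_one]
    rfl
  change nOp ε ν g * sOp m ε ν hν 1 = _
  rw [h1, mul_one]

theorem iwasawaRep_inr [SigmaFinite ν] (hν : IsAlmostInvariant ν) (s₀ : S p) :
    iwasawaRep m ε ν hν (SemidirectProduct.inr s₀) = sOp m ε ν hν s₀ := by
  have h1 : nOp (m := m) ε ν 1 = 1 := by
    ext1 f
    refine Lp.ext ((nOp_coeFn ε ν 1 f).trans ?_)
    simp only [map_one]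
    rfl
  change nOp ε ν 1 * sOp m ε ν hν s₀ = _
  rw [h1, one_mul]

theorem bargmann_inner_smul_right (a b : bargmannSpace m ε) (c : ℂ) :
    inner ℂ a (c • b) = c * inner ℂ a b :=
  inner_smul_right a b c

theorem bargmann_inner_smul_left (a b : bargmannSpace m ε) (c : ℂ) :
    inner ℂ (c • a) b = conj c * inner ℂ a b :=
  inner_smul_left a b c

/-- Matrix coefficients of intertwining operators have the same Fourier transforms. -/
theorem integral_character_inner (A : DirectIntegral m ε ν →L[ℂ] DirectIntegral m ε' ν')
    (hA : ∀ g f, A (nOp ε ν g f) = nOp ε' ν' g (A f)) {k : DirectIntegral m ε ν}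
    {h : DirectIntegral m ε' ν'} (hk : ∀ f : DirectIntegral m ε ν,
      ∫ s, inner ℂ (k s) (f s) ∂ν = ∫ s, inner ℂ (h s) (A f s) ∂ν')
    (f : DirectIntegral m ε ν) (b : Z p p) :
    ∫ s, character b (form ε s) * inner ℂ (k s) (f s) ∂ν =
      ∫ s, character b (form ε' s) * inner ℂ (h s) (A f s) ∂ν' := by
  -- Inserting a central element into the adjoint relation multiplies the integrands by the
  -- characters of `form ε s` and `form ε' s`.
  have key := hk (nOp ε ν (central m b) f)
  rw [hA] at key
  refine Eq.trans ?_ (key.trans ?_)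
  · refine integral_congr_ae ?_
    filter_upwards [nOp_coeFn ε ν (central m b) f] with s hs
    rw [hs, bargmannRepAt_central, bargmann_inner_smul_right]
  · refine integral_congr_ae ?_
    filter_upwards [nOp_coeFn ε' ν' (central m b) (A f)] with s hs
    rw [hs, bargmannRepAt_central, bargmann_inner_smul_right]

/-- There are no intertwining operators for different signs. -/
theorem eq_zero_of_intertwining (hε : ε ≠ ε')
    (A : DirectIntegral m ε ν →L[ℂ] DirectIntegral m ε' ν')
    (hA : ∀ g f, A (nOp ε ν g f) = nOp ε' ν' g (A f)) : A = 0 := by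
  ext1 f
  -- With `h = A f` the right-hand density is `‖A f(s)‖²`. Over the range of `form ε'` its integral
  -- is the full norm, while the left-hand integral is over the empty set.
  obtain ⟨k, hk⟩ := exists_adjoint_Lp A (A f)
  refine Lp_eq_zero_of_integral_inner ?_
  have h1 := setIntegral_preimage_eq (L2.integrable_inner (𝕜 := ℂ) k f)
    (L2.integrable_inner (𝕜 := ℂ) (A f) (A f)) (continuous_form ε).measurable
    (continuous_form ε').measurable (integral_character_inner A hA hk f)
    (measurableEmbedding_form ε').measurableSet_range
  have h2 : form ε ⁻¹' Set.range (form ε') = ∅ := by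
    refine Set.eq_empty_of_forall_notMem fun s => ?_
    rintro ⟨t, ht⟩
    exact disjoint_range_form hε s t ht.symm
  rw [h2, Set.preimage_range, setIntegral_empty, setIntegral_univ] at h1
  exact h1.symm

/-- The operators commuting with the centre of `N` are local. -/
theorem ae_inner_adjoint_eq (A : DirectIntegral m ε ν →L[ℂ] DirectIntegral m ε ν)
    (hA : ∀ g f, A (nOp ε ν g f) = nOp ε ν g (A f)) {h k : DirectIntegral m ε ν}
    (hk : ∀ f : DirectIntegral m ε ν,
      ∫ s, inner ℂ (k s) (f s) ∂ν = ∫ s, inner ℂ (h s) (A f s) ∂ν) (f : DirectIntegral m ε ν) :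
    ∀ᵐ s ∂ν, inner ℂ (k s) (f s) = inner ℂ (h s) (A f s) := by
  have i1 := L2.integrable_inner (𝕜 := ℂ) k f
  have i2 := L2.integrable_inner (𝕜 := ℂ) h (A f)
  refine Integrable.ae_eq_of_forall_setIntegral_eq _ _ i1 i2 fun E hE _ => ?_
  -- Every Borel set of `S` is the preimage of its own Borel image under `form ε`, so equality of
  -- image measures is equality on all Borel sets of `S`.
  have h1 := setIntegral_preimage_eq i1 i2 (continuous_form ε).measurable
    (continuous_form ε).measurable (integral_character_inner A hA hk f)
    ((measurableEmbedding_form ε).measurableSet_image.2 hE)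
  rwa [Set.preimage_image_eq _ (measurableEmbedding_form ε).injective] at h1

theorem conjN_heis (s : S p) (z : Z p m) : conjN s (heis z) = heis (act s z) := by
  ext1 <;> simp [conjN, heis]

theorem continuous_bargmannRep_heis (ε : Fin p → ℤˣ) (f : bargmannSpace m ε) :
    Continuous fun z => bargmannRep m ε (heis z) f :=
  Continuous.subtype_mk (continuous_weylOp ε (g := heis) continuous_const continuous_id f.1) _

/-- Applying the local identity to `T(0,v) f` gives it for each fixed `v` off a null set depending
on `v`. A dense sequence and strong continuity give a single null set, and since `v ↦ s v` is onto,
the fibre parameter `z = s v` is arbitrary. -/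
theorem ae_inner_adjoint_bargmannRep (A : DirectIntegral m ε ν →L[ℂ] DirectIntegral m ε ν)
    (hA : ∀ g f, A (nOp ε ν g f) = nOp ε ν g (A f)) {h k : DirectIntegral m ε ν}
    (hk : ∀ f : DirectIntegral m ε ν,
      ∫ s, inner ℂ (k s) (f s) ∂ν = ∫ s, inner ℂ (h s) (A f s) ∂ν) (f : DirectIntegral m ε ν) :
    ∀ᵐ s ∂ν, ∀ z, inner ℂ (k s) (bargmannRep m ε (heis z) (f s)) =
      inner ℂ (h s) (bargmannRep m ε (heis z) (A f s)) := by
  have h1 : ∀ v : Z p m, ∀ᵐ s ∂ν,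
      inner ℂ (k s) (bargmannRep m ε (heis (act s v)) (f s)) =
      inner ℂ (h s) (bargmannRep m ε (heis (act s v)) (A f s)) := fun v => by
    filter_upwards [ae_inner_adjoint_eq A hA hk (nOp ε ν (heis v) f),
      nOp_coeFn ε ν (heis v) f, nOp_coeFn ε ν (heis v) (A f)] with s hs h2 h3
    rw [hA, h2, h3] at hs
    rw [← conjN_heis]
    exact hs
  filter_upwards [ae_all_iff.2 fun k => h1 (TopologicalSpace.denseSeq (Z p m) k)] with s hs z
  have hact : Continuous fun v : Z p m => act s v :=
    Continuous.matrix_mul (A := fun _ : Z p m => mat s) (B := fun v : Z p m => Matrix.of v)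
      continuous_const continuous_id
  have h2 : (fun v => inner ℂ (k s) (bargmannRep m ε (heis (act s v)) (f s))) =
      fun v => inner ℂ (h s) (bargmannRep m ε (heis (act s v)) (A f s)) := by
    refine Continuous.ext_on (TopologicalSpace.denseRange_denseSeq (Z p m)) ?_ ?_ ?_
    · exact continuous_const.inner ((continuous_bargmannRep_heis ε _).comp hact)
    · exact continuous_const.inner ((continuous_bargmannRep_heis ε _).comp hact)
    · rintro _ ⟨k, rfl⟩
      exact hs k
  have h3 := congrFun h2 (act s⁻¹ z)
  simpa only [← act_mul, mul_inv_cancel, act_one] using h3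

theorem exists_pos_memLp (ν : Measure (S p)) [SigmaFinite ν] :
    ∃ φ : S p → ℝ, (∀ s, 0 < φ s) ∧ Measurable φ ∧ MemLp φ 2 ν := by
  obtain ⟨g, hg, hgm, hgi⟩ := exists_pos_lintegral_lt_of_sigmaFinite ν one_ne_zero
  have hm : Measurable fun s => √(g s : ℝ) := hgm.coe_nnreal_real.sqrt
  refine ⟨fun s => √(g s : ℝ), fun s => Real.sqrt_pos.2 (hg s), hm, ?_⟩
  rw [memLp_two_iff_integrable_sq hm.aestronglyMeasurable]
  simp only [Real.sq_sqrt (NNReal.coe_nonneg _)]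
  refine ⟨hgm.coe_nnreal_real.aestronglyMeasurable, ?_⟩
  simpa [HasFiniteIntegral] using hgi.trans ENNReal.one_lt_top

/-- There is a section all of whose values are nonzero multiples of the vacuum. -/
theorem exists_vacuum_section (m : ℕ) (ε : Fin p → ℤˣ) (ν : Measure (S p)) [SigmaFinite ν] :
    ∃ (φ : S p → ℝ) (Ψ : DirectIntegral m ε ν), (∀ s, 0 < φ s) ∧ Measurable φ ∧
      ∀ᵐ s ∂ν, Ψ s = (φ s : ℂ) • vacuum m ε := by
  obtain ⟨φ, h0, hm, hφ⟩ := exists_pos_memLp ν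
  have h1 : MemLp (fun s => (φ s : ℂ) • vacuum m ε) 2 ν :=
    (ContinuousLinearMap.toSpanSingleton ℂ (vacuum m ε)).comp_memLp' hφ.ofReal
  exact ⟨φ, h1.toLp, h0, hm, h1.coeFn_toLp⟩

theorem nontrivial_directIntegral (m : ℕ) (ε : Fin p → ℤˣ) (ν : Measure (S p)) [SigmaFinite ν]
    (h0 : ν ≠ 0) : Nontrivial (DirectIntegral m ε ν) := by
  obtain ⟨φ, Ψ, hφ, -, hΨ⟩ := exists_vacuum_section m ε ν
  refine ⟨Ψ, 0, ?_⟩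
  rintro rfl
  have := ae_neBot.2 h0
  obtain ⟨s, hs, hs'⟩ := (hΨ.and (Lp.coeFn_zero (bargmannSpace m ε) 2 ν)).exists
  rw [hs', Pi.zero_apply] at hs
  rcases smul_eq_zero.1 hs.symm with h | h
  · exact (hφ s).ne' (Complex.ofReal_eq_zero.1 h)
  · exact vacuum_ne_zero ε h

/-- The fibre step at `f = Ψ`, with `r = φ(s)`, `a = A Ψ(s)` and `k = A* Ψ(s)`. The coefficient is
kept as (multiplier) · `r`, with the multiplier given by an explicit inner product so that its
measurability in `s` is visible. -/
theorem eq_conj_smul_vacuum {a k : bargmannSpace m ε} {r : ℝ} (hr : r ≠ 0)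
    (h : ∀ z, inner ℂ k (bargmannRep m ε (heis z) ((r : ℂ) • vacuum m ε)) =
      inner ℂ ((r : ℂ) • vacuum m ε) (bargmannRep m ε (heis z) a)) :
    k = conj (inner ℂ (vacuum m ε) a / (gaussianMass p m * r) * r) • vacuum m ε := by
  have hr0 : (r : ℂ) ≠ 0 := Complex.ofReal_ne_zero.2 hr
  have hM0 : (gaussianMass p m : ℂ) ≠ 0 := Complex.ofReal_ne_zero.2 gaussianMass_ne_zero
  obtain ⟨c, hc, hc'⟩ := eq_smul_vacuum (a := a) (b := k) fun z => by
    have h1 := h z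
    rw [map_smul, bargmann_inner_smul_right, bargmann_inner_smul_left, Complex.conj_ofReal] at h1
    exact mul_left_cancel₀ hr0 h1
  have h2 : inner ℂ (vacuum m ε) a = c * gaussianMass p m := by
    rw [hc, bargmann_inner_smul_right, inner_vacuum_self]
  have h3 : inner ℂ (vacuum m ε) a / (gaussianMass p m * r) * r = c := by
    rw [h2]
    field_simp
  rw [h3, hc']

/-- The fibre step for arbitrary `f`: all coefficients of `a - c f` with the vacuum vanish, and the
vacuum is cyclic. -/
theorem eq_smul_of_inner_vacuum {a f : bargmannSpace m ε} {r : ℝ} (hr : r ≠ 0) {c : ℂ}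
    (h : ∀ z, inner ℂ (conj (c * r) • vacuum m ε) (bargmannRep m ε (heis z) f) =
      inner ℂ ((r : ℂ) • vacuum m ε) (bargmannRep m ε (heis z) a)) : a = c • f := by
  rw [← sub_eq_zero]
  refine eq_zero_of_inner_vacuum fun z => ?_
  have h1 := h z
  rw [bargmann_inner_smul_left, bargmann_inner_smul_left, Complex.conj_conj,
    Complex.conj_ofReal] at h1
  rw [map_sub, map_smul]
  refine (inner_sub_right (𝕜 := ℂ) (vacuum m ε) _ _).trans ?_
  rw [bargmann_inner_smul_right]
  refine mul_left_cancel₀ (Complex.ofReal_ne_zero.2 hr) ?_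
  linear_combination -h1

/-- An operator that commutes with the operators of `N` is the multiplication by a function. -/
theorem exists_measurable_multiplier [SigmaFinite ν]
    (A : DirectIntegral m ε ν →L[ℂ] DirectIntegral m ε ν)
    (hA : ∀ g f, A (nOp ε ν g f) = nOp ε ν g (A f)) :
    ∃ c : S p → ℂ, Measurable c ∧ ∀ f, ∀ᵐ s ∂ν, A f s = c s • f s := by
  obtain ⟨φ, Ψ, hφ, hφm, hΨ⟩ := exists_vacuum_section m ε ν
  obtain ⟨k, hk⟩ := exists_adjoint_Lp A Ψ
  -- If `A Ψ = c Ψ`, pairing with the vacuum forces this value of `c`. It depends only on `Ψ`, so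
  -- one function serves every `f`.
  obtain ⟨c₀, hc₀⟩ : ∃ c₀ : S p → ℂ, ∀ s, c₀ s =
      inner ℂ (vacuum m ε) (A Ψ s) / ((gaussianMass p m : ℂ) * φ s) := ⟨_, fun _ => rfl⟩
  have hc₀m : AEMeasurable c₀ ν := by
    rw [funext hc₀]
    exact (aemeasurable_inner_const (vacuum m ε) (A Ψ)).div
      (((Complex.measurable_ofReal.comp hφm).const_mul _).aemeasurable)
  have hc₀s : ∀ᵐ s ∂ν, k s = conj (c₀ s * φ s) • vacuum m ε := by
    filter_upwards [ae_inner_adjoint_bargmannRep A hA hk Ψ, hΨ] with s h1 h2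
    rw [h2] at h1
    rw [hc₀]
    exact eq_conj_smul_vacuum (hφ s).ne' h1
  refine ⟨hc₀m.mk c₀, hc₀m.measurable_mk, fun f => ?_⟩
  filter_upwards [ae_inner_adjoint_bargmannRep A hA hk f, hΨ, hc₀s, hc₀m.ae_eq_mk]
    with s h1 h2 h3 h4
  rw [h2, h3] at h1
  rw [← h4]
  exact eq_smul_of_inner_vacuum (hφ s).ne' h1

theorem isOperatorIrreducible_iwasawaRep [SigmaFinite ν] (hν : IsAlmostInvariant ν) (h0 : ν ≠ 0) :
    IsOperatorIrreducible (H := DirectIntegral m ε ν) (iwasawaRep m ε ν hν) := by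
  refine ⟨nontrivial_directIntegral m ε ν h0, fun A hA => ?_⟩
  have hN : ∀ g f, A (nOp ε ν g f) = nOp ε ν g (A f) := fun g f => by
    have h1 := hA (SemidirectProduct.inl g)
    rw [iwasawaRep_inl] at h1
    exact DFunLike.congr_fun h1 f
  have hS : ∀ s₀ f, A (sOp m ε ν hν s₀ f) = sOp m ε ν hν s₀ (A f) := fun s₀ f => by
    have h1 := hA (SemidirectProduct.inr s₀)
    rw [iwasawaRep_inr] at h1
    exact DFunLike.congr_fun h1 f
  obtain ⟨c, hcm, hc⟩ := exists_measurable_multiplier A hN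
  obtain ⟨φ, Ψ, hφ, -, hΨ⟩ := exists_vacuum_section m ε ν
  -- Both `A T(s₀) Ψ` and `T(s₀) A Ψ` are evaluated at `s`; the common vector `Ψ(s s₀)` is nonzero
  -- and can be cancelled.
  have hinv : ∀ s₀, ∀ᵐ s ∂ν, c (s * s₀) = c s := fun s₀ => by
    have h1 := hc (sOp m ε ν hν s₀ Ψ)
    rw [hS] at h1
    filter_upwards [h1, sOp_coeFn ε ν hν s₀ (A Ψ), sOp_coeFn ε ν hν s₀ Ψ,
      (quasi_mul hν s₀).ae (hc Ψ), (quasi_mul hν s₀).ae hΨ] with s k1 k2 k3 k4 k5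
    rw [k2, k3, k4, k5] at k1
    have h2 : (φ (s * s₀) : ℂ) • vacuum m ε ≠ 0 :=
      smul_ne_zero (Complex.ofReal_ne_zero.2 (hφ _).ne') (vacuum_ne_zero ε)
    exact smul_left_injective ℂ h2 k1
  obtain ⟨b, hb⟩ := exists_ae_eq_const hν hcm hinv
  refine ⟨b, ?_⟩
  ext1 f
  refine Lp.ext ?_
  filter_upwards [hc f, hb, Lp.coeFn_smul b f] with s h1 h2 h3
  rw [h1, h2]
  exact h3.symm

theorem not_areEquivalent_iwasawaRep [SigmaFinite ν] [SigmaFinite ν'] (hν : IsAlmostInvariant ν)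
    (hν' : IsAlmostInvariant ν') (h0 : ν ≠ 0) (hε : ε ≠ ε') :
    ¬ AreEquivalent (H := DirectIntegral m ε ν) (H' := DirectIntegral m ε' ν')
      (iwasawaRep m ε ν hν) (iwasawaRep m ε' ν' hν') := by
  rintro ⟨A, hA⟩
  have h1 := eq_zero_of_intertwining hε (A : DirectIntegral m ε ν →L[ℂ] DirectIntegral m ε' ν')
    fun g f => by
      have := hA (SemidirectProduct.inl g) f
      rwa [iwasawaRep_inl, iwasawaRep_inl] at this
  have := nontrivial_directIntegral m ε ν h0
  obtain ⟨f, hf⟩ := exists_ne (0 : DirectIntegral m ε ν)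
  exact hf (A.injective ((DFunLike.congr_fun h1 f).trans (map_zero A).symm))

end intertwining

end Iwasawa

end

/-- Let `q ≥ p`, and let `P = S ⋌ N` be the Iwasawa group of `U(p, q)`. For every nonzero
σ-finite almost invariant measure `ν` on `S` the representations `T_ε`, `ε = (±1, …, ±1)`, of `P`
associated with `ν` are operator-irreducible. For `ε ≠ ε'` they are nonequivalent, even if they
are associated with different almost invariant measures. -/
theorem theorem7 (p q : ℕ) (hpq : p ≤ q) :
    (∀ (ε : Fin p → ℤˣ) (ν : MeasureTheory.Measure (Iwasawa.S p)) [MeasureTheory.SigmaFinite ν]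
        (hν : Iwasawa.IsAlmostInvariant ν), ν ≠ 0 →
      Iwasawa.IsOperatorIrreducible (H := Iwasawa.DirectIntegral (q - p) ε ν)
        (Iwasawa.iwasawaRep (q - p) ε ν hν)) ∧
    (∀ (ε ε' : Fin p → ℤˣ) (ν ν' : MeasureTheory.Measure (Iwasawa.S p))
        [MeasureTheory.SigmaFinite ν] [MeasureTheory.SigmaFinite ν']
        (hν : Iwasawa.IsAlmostInvariant ν) (hν' : Iwasawa.IsAlmostInvariant ν'),
      ν ≠ 0 → ν' ≠ 0 → ε ≠ ε' →
      ¬ Iwasawa.AreEquivalent (H := Iwasawa.DirectIntegral (q - p) ε ν)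
        (H' := Iwasawa.DirectIntegral (q - p) ε' ν') (Iwasawa.iwasawaRep (q - p) ε ν hν)
        (Iwasawa.iwasawaRep (q - p) ε' ν' hν')) := by
  exact ⟨fun ε ν _ hν h0 => Iwasawa.isOperatorIrreducible_iwasawaRep hν h0,
    fun ε ε' ν ν' _ _ hν hν' h0 _ hε => Iwasawa.not_areEquivalent_iwasawaRep hν hν' h0 hε⟩
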